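/- Let $R,\alpha>0$, $p,q\in\mathbb C$ with $q\ne 0$, $\lambda:=\frac{p-q}{\alpha}$, let $s:[0,R]\to(0,\infty)$ be smooth, and let $\gamma:\Omega\to\mathbb C$ be smooth, where $\Omega:=[0,R]\times I$, $I:=[0,1]$. Put $\delta:=\dot s/s$, $\zeta:=\frac{(1+q\gamma)s^2}{\alpha^2q}$, $\xi:=\frac{\lambda s^2}{\alpha^2q^2}$ and $\Lambda(r)v:=-v''-\zeta(r,\cdot)v$. Consider the initial-boundary-value problem $$\Lambda(r)\Big(u_r-\mathrm i\tfrac{\lambda}{q}u-\delta(r)\,y\,u_y\Big)=\mathrm i\,\xi(r)\,u\ \text{ on }\Omega,\qquad u(r,0)=u(r,1)=u_y(r,1)=0,\qquad u(0,\cdot)=u_0 .\tag{P}$$ For integers $J\ge 3$, $N\ge 1$ let $h=1/J$, $y_j=jh$, $k=R/N$, $r^n=nk$, $r^{n-\frac12}=\frac{r^n+r^{n-1}}2$, and $X_h=\{(v_j)_{j=0}^J\in\mathbb C^{J+1}: v_0=v_J=0\}$. On $X_h$ put $\|v\|_{0,h}^2=h\sum_{j=1}^{J-1}|v_j|^2$,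 $|v|_{1,h}^2=h\sum_{j=0}^{J-1}\big|\frac{v_{j+1}-v_j}{h}\big|^2$, $|v|_{\infty,h}=\max_{1\le j\le J-1}|v_j|$ and, for $1\le j\le J-1$, $(\partial_hv)_j=\frac{v_{j+1}-v_{j-1}}{2h}$, $(v\otimes w)_j=v_jw_j$, $\omega_j=y_j$, and $$(\Lambda_h(r)v)_j=-\tfrac{v_{j-1}-2v_j+v_{j+1}}{h^2}-\zeta(r,y_j)v_j .$$ Let $C_{DPF}$ be the optimal constant in $\|v\|_{0,h}\le C_{DPF}|v|_{1,h}$, $v\in X_h$. Assume that either $$\inf_\Omega\Big[\tfrac1{C_{DPF}^2}-\tfrac{s^2}{\alpha^2|q|^2}\big(\mathrm{Re}(q)+|q|^2\mathrm{Re}(\gamma)\big)\Big]>0,$$ or there is $\delta_\star\in\{1,-1\}$ with $$\inf_\Omega\Big[\tfrac{\delta_\star s^2}{\alpha^2|q|^2}\big(\mathrm{Im}(q)-|q|^2\mathrm{Im}(\gamma)\big)\Big]>0 .$$ Then $\Lambda_h(r)$ is invertible for all $r\in[0,R]$; let $T_h(r)=\Lambda_h(r)^{-1}$. Moreover there is a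 constant $C>0$, depending only on $R,\alpha,p,q,s,\gamma$ (not on $J,N,u_0,u$), with the following property. Let $u\in C^4(\Omega;\mathbb C)$ solve (P), let $u^n\in X_h$ have the interior entries $(u^n)_j=u(r^n,y_j)$, and define $\eta^n\in X_h$, $1\le n\le N$, by $$\tfrac{u^n-u^{n-1}}{k}-\delta(r^{n-\frac12})\,\omega\otimes\partial_h\big(\tfrac{u^n+u^{n-1}}2\big)=\mathrm i\,\xi(r^{n-\frac12})\,T_h(r^{n-\frac12})\big(\tfrac{u^n+u^{n-1}}2\big)+\mathrm i\tfrac\lambda q\big(\tfrac{u^n+u^{n-1}}2\big)+\eta^n .$$ Write $|f|_{\infty,\Omega}=\max_\Omega|f|$ and $|f|_{m,\infty,I}=\max_I|f^{(m)}|$. Then $$\max_{1\le m\le N}|\eta^m|_{\infty,h}\le C\,[\,k^2\mathcal B_1(u)+h^2\mathcal B_2(u)\,],$$ where $\mathcal B_1(u)=|u_{rrr}|_{\infty,\Omega}+|u_{yrr}|_{\infty,\Omega}+|u_{rr}|_{\infty,\Omega}$ and $\mathcal B_2(u)=\max_{[0,R]}|u|_{3,\infty,I}$, and $$\begin{aligned}\max_{2\le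 n\le N}|\eta^n-\eta^{n-1}|_{\infty,h}\le C\Big[&k^3\big(|\partial_r^4u|_{\infty,\Omega}+|\partial_r^3u|_{\infty,\Omega}+|\partial_r^2\partial_yu|_{\infty,\Omega}+|\partial_r^3\partial_yu|_{\infty,\Omega}\big)\\&+h^3\big(|\partial_y^4u|_{\infty,\Omega}+\max_{[0,R]}|u|_{3,\infty,I}\big)\\&+kh^2\big(|\partial_y^3u|_{\infty,\Omega}+|\partial_r\partial_y^3u|_{\infty,\Omega}+\max_{[0,R]}|u|_{2,\infty,I}+\max_{[0,R]}|u_r|_{2,\infty,I}\big)\Big].\end{aligned}$$ -/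

import Mathlib

open Set
open scoped ContDiff

noncomputable section

namespace CNFD

/-- The data of the transformed wide-angle problem on `[0,R] × [0,1]`, with the standing
assumptions: `R, α > 0`, `q ≠ 0`, a smooth positive bottom profile `s` on `[0,R]`, and a smooth
complex-valued coefficient `γ` on `[0,R] × [0,1]` (`γ(r,y) = β(r, y s(r))`). -/
structure Data where
  R : ℝ
  α : ℝ
  p : ℂ
  q : ℂ
  s : ℝ → ℝ
  γ : ℝ → ℝ → ℂ
  R_pos : 0 < R
  α_pos : 0 < α
  q_ne_zero : q ≠ 0
  s_pos : ∀ r ∈ Icc 0 R, 0 < s r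
  s_smooth : ContDiffOn ℝ ∞ s (Icc 0 R)
  γ_smooth : ContDiffOn ℝ ∞ (Function.uncurry γ) (Icc 0 R ×ˢ Icc 0 1)

/-! ### Grid functions -/

/-- The space of grid functions `(v_0, …, v_J)` with `v_0 = v_J = 0`. A grid function is stored as
a sequence on `ℕ` that is extended by zero beyond the index `J`. -/
def Xh (J : ℕ) : Submodule ℂ (ℕ → ℂ) where
  carrier := {v | v 0 = 0 ∧ ∀ j, J ≤ j → v j = 0}
  add_mem' := by
    rintro v w ⟨hv, hv'⟩ ⟨hw, hw'⟩
    exact ⟨by simp [hv, hw], fun j hj => by simp [hv' j hj, hw' j hj]⟩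
  zero_mem' := ⟨rfl, fun _ _ => rfl⟩
  smul_mem' := by
    rintro c v ⟨hv, hv'⟩
    exact ⟨by simp [hv], fun j hj => by simp [hv' j hj]⟩

/-- The grid function with the values `f j` at the interior indices `j = 1, …, J-1`. -/
def ofInterior (J : ℕ) (f : ℕ → ℂ) : Xh J :=
  ⟨fun j => if 0 < j ∧ j < J then f j else 0,
    by simp, fun j hj => by simp [Nat.not_lt.mpr hj]⟩

/-- The mesh width `h = 1/J`. -/
def mesh (J : ℕ) : ℝ := 1 / (J : ℝ)

/-- The nodes `y_j = j h`. -/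
def node (J j : ℕ) : ℝ := (j : ℝ) * mesh J

/-- The discrete `L²` norm `‖v‖_{0,h}`. -/
def norm0 {J : ℕ} (v : Xh J) : ℝ :=
  Real.sqrt (mesh J * ∑ j ∈ Finset.Ioo 0 J, ‖v.1 j‖ ^ 2)

/-- The discrete `H¹` seminorm `|v|_{1,h}`. -/
def semi1 {J : ℕ} (v : Xh J) : ℝ :=
  Real.sqrt (mesh J * ∑ j ∈ Finset.range J, ‖(v.1 (j + 1) - v.1 j) / (mesh J : ℂ)‖ ^ 2)

/-- The discrete maximum norm `|v|_{∞,h} = max_{1 ≤ j ≤ J-1} |v_j|`. -/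
def normInf {J : ℕ} (v : Xh J) : ℝ :=
  ((Finset.Ioo 0 J).sup fun j => ‖v.1 j‖₊ : NNReal)

/-- The optimal constant in the discrete Poincaré–Friedrichs inequality
`‖v‖_{0,h} ≤ c |v|_{1,h}`, `v ∈ X_h`. -/
def discretePF (J : ℕ) : ℝ :=
  sInf {c : ℝ | 0 ≤ c ∧ ∀ v : Xh J, norm0 v ≤ c * semi1 v}

/-- The second-order difference operator `Δ_h`. -/
def laplacian (J : ℕ) : Xh J →ₗ[ℂ] Xh J where
  toFun v := ofInterior J fun j =>
    (v.1 (j - 1) - 2 * v.1 j + v.1 (j + 1)) / (mesh J : ℂ) ^ 2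
  map_add' v w := by
    ext j
    by_cases hj : 0 < j ∧ j < J
    · simp [ofInterior, hj]; ring
    · simp [ofInterior, hj]
  map_smul' c v := by
    ext j
    by_cases hj : 0 < j ∧ j < J
    · simp [ofInterior, hj]; ring
    · simp [ofInterior, hj]

/-- The componentwise product `v ⊗ w`. -/
def tensor {J : ℕ} (v w : Xh J) : Xh J := ofInterior J fun j => v.1 j * w.1 j

/-- The central difference operator `∂_h`. -/
def centralDiff {J : ℕ} (v : Xh J) : Xh J :=
  ofInterior J fun j => (v.1 (j + 1) - v.1 (j - 1)) / (2 * (mesh J : ℂ))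

/-- The grid function `ω` with `ω_j = y_j` for `j = 0, …, J-1`. -/
def omega (J : ℕ) : Xh J := ofInterior J fun j => (node J j : ℂ)

/-- The nodal interpolation `P_h f`. -/
def interp (J : ℕ) (f : ℝ → ℂ) : Xh J := ofInterior J fun j => f (node J j)

/-! ### Seminorms of functions on `I = [0,1]` -/

/-- `|f|_{m,∞,I} = max_I |f^{(m)}|`. -/
def semiI (m : ℕ) (f : ℝ → ℂ) : ℝ :=
  sSup ((fun y => ‖iteratedDerivWithin m f (Icc 0 1) y‖) '' Icc (0 : ℝ) 1)

namespace Data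

variable (D : Data)

/-- The strip `Ω = [0,R] × [0,1]`. -/
def Ω : Set (ℝ × ℝ) := Icc 0 D.R ×ˢ Icc 0 1

/-- `λ = (p - q)/α`. -/
def lam : ℂ := (D.p - D.q) / (D.α : ℂ)

/-- `δ(r) = ṡ(r)/s(r)`. -/
def δ (r : ℝ) : ℝ := derivWithin D.s (Icc 0 D.R) r / D.s r

/-- `ζ(r,y) = (1 + q γ(r,y)) s²(r) / (α² q)`. -/
def ζ (r y : ℝ) : ℂ :=
  (1 + D.q * D.γ r y) * (D.s r : ℂ) ^ 2 / ((D.α : ℂ) ^ 2 * D.q)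

/-- `ξ(r) = λ s²(r) / (α² q²)`. -/
def ξ (r : ℝ) : ℂ := D.lam * (D.s r : ℂ) ^ 2 / ((D.α : ℂ) ^ 2 * D.q ^ 2)

/-- The partial derivative `∂_r f` on `Ω` (one-sided at `r = 0` and `r = R`). -/
def dr (f : ℝ → ℝ → ℂ) : ℝ → ℝ → ℂ :=
  fun r y => derivWithin (fun t => f t y) (Icc 0 D.R) r

end Data

/-- The partial derivative `∂_y f` on `Ω` (one-sided at `y = 0` and `y = 1`). -/
def dy (f : ℝ → ℝ → ℂ) : ℝ → ℝ → ℂ :=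
  fun r y => derivWithin (fun x => f r x) (Icc 0 1) y

namespace Data

variable (D : Data)

/-- `|f|_{∞,Ω} = max_Ω |f|`. -/
def supΩ (f : ℝ → ℝ → ℂ) : ℝ := sSup ((fun x : ℝ × ℝ => ‖f x.1 x.2‖) '' D.Ω)

/-- `max_{[0,R]} |f|_{m,∞,I}`. -/
def maxSemiI (m : ℕ) (f : ℝ → ℝ → ℂ) : ℝ :=
  sSup ((fun r => semiI m (f r)) '' Icc 0 D.R)

/-- The differential operator `Λ(r) v = - v'' - ζ(r,·) v`. -/
def ellip (r : ℝ) (v : ℝ → ℂ) : ℝ → ℂ :=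
  fun y => - iteratedDerivWithin 2 v (Icc 0 1) y - D.ζ r y * v y

/-- `u` solves the transformed initial-boundary-value problem with initial value `u₀`. -/
structure IsSolution (u₀ : ℝ → ℂ) (u : ℝ → ℝ → ℂ) : Prop where
  pde : ∀ r ∈ Icc 0 D.R, ∀ y ∈ Icc (0 : ℝ) 1,
    D.ellip r (fun x => D.dr u r x - Complex.I * (D.lam / D.q) * u r x
      - (D.δ r : ℂ) * (x : ℂ) * dy u r x) y = Complex.I * D.ξ r * u r y
  top : ∀ r ∈ Icc 0 D.R, u r 0 = 0
  bottom : ∀ r ∈ Icc 0 D.R, u r 1 = 0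
  bottom_deriv : ∀ r ∈ Icc 0 D.R, dy u r 1 = 0
  init : ∀ y ∈ Icc (0 : ℝ) 1, u 0 y = u₀ y

/-- The discrete elliptic operator `Λ_h(r)`. -/
def ellipH (J : ℕ) (r : ℝ) : Module.End ℂ (Xh J) where
  toFun v := - laplacian J v - ofInterior J fun j => D.ζ r (node J j) * v.1 j
  map_add' v w := by
    rw [map_add]
    ext j
    by_cases hj : 0 < j ∧ j < J
    · simp [ofInterior, hj]; ring
    · simp [ofInterior, hj]; ring
  map_smul' c v := by
    rw [map_smul]
    ext j
    by_cases hj : 0 < j ∧ j < J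
    · simp [ofInterior, hj]; ring
    · simp [ofInterior, hj]

/-- `T_h(r) = Λ_h(r)⁻¹` (the zero map if `Λ_h(r)` is not invertible). -/
def solH (J : ℕ) (r : ℝ) : Module.End ℂ (Xh J) := Ring.inverse (D.ellipH J r)

/-- The real-part condition: the infimum over `Ω` of
`1/C² - s²/(α²|q|²) (Re q + |q|² Re γ)` is positive, where `C` is the optimal discrete
Poincaré–Friedrichs constant. -/
def CondRe (J : ℕ) : Prop :=
  0 < sInf ((fun x : ℝ × ℝ => 1 / discretePF J ^ 2
    - D.s x.1 ^ 2 / (D.α ^ 2 * ‖D.q‖ ^ 2) *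
      (D.q.re + ‖D.q‖ ^ 2 * (D.γ x.1 x.2).re)) '' D.Ω)

/-- The imaginary-part condition: for some `δ⋆ ∈ {1, -1}` the infimum over `Ω` of
`δ⋆ s²/(α²|q|²) (Im q - |q|² Im γ)` is positive. -/
def CondIm : Prop :=
  ∃ d : ℝ, (d = 1 ∨ d = -1) ∧
    0 < sInf ((fun x : ℝ × ℝ => d * D.s x.1 ^ 2 / (D.α ^ 2 * ‖D.q‖ ^ 2) *
      (D.q.im - ‖D.q‖ ^ 2 * (D.γ x.1 x.2).im)) '' D.Ω)

/-- The range step `k = R/N`. -/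
def step (N : ℕ) : ℝ := D.R / (N : ℝ)

/-- The range nodes `r^n = n k`. -/
def rnode (N n : ℕ) : ℝ := (n : ℝ) * D.step N

/-- The midpoint `r^{n-1/2} = (r^n + r^{n-1})/2`, for `n ≥ 1`. -/
def rmid (N n : ℕ) : ℝ := (D.rnode N n + D.rnode N (n - 1)) / 2

/-- `u^n ∈ X_h`, the nodal values of `u(r^n, ·)`. -/
def exactAt (J N : ℕ) (u : ℝ → ℝ → ℂ) (n : ℕ) : Xh J := interp J (u (D.rnode N n))

/-- The average `(u^n + u^{n-1})/2`, for `n ≥ 1`. -/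
def avgAt (J N : ℕ) (u : ℝ → ℝ → ℂ) (n : ℕ) : Xh J :=
  (1 / 2 : ℂ) • (D.exactAt J N u n + D.exactAt J N u (n - 1))

/-- `e` is the truncation error `η^n` of the Crank–Nicolson finite difference scheme at step `n`:
`(u^n - u^{n-1})/k - δ ω ⊗ ∂_h ū = i ξ T_h ū + i (λ/q) ū + η^n`, with `ū = (u^n + u^{n-1})/2` and
`δ`, `ξ`, `T_h` taken at `r^{n-1/2}`. -/
def IsTruncationError (J N : ℕ) (u : ℝ → ℝ → ℂ) (n : ℕ) (e : Xh J) : Prop :=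
  (1 / (D.step N : ℂ)) • (D.exactAt J N u n - D.exactAt J N u (n - 1))
      - (D.δ (D.rmid N n) : ℂ) • tensor (omega J) (centralDiff (D.avgAt J N u n))
    = (Complex.I * D.ξ (D.rmid N n)) • D.solH J (D.rmid N n) (D.avgAt J N u n)
      + (Complex.I * (D.lam / D.q)) • D.avgAt J N u n + e

/-- `B₁(u) = |u_rrr| + |u_yrr| + |u_rr|` in the maximum norm on `Ω`. -/
def B1 (u : ℝ → ℝ → ℂ) : ℝ :=
  D.supΩ (D.dr^[3] u) + D.supΩ (D.dr^[2] (dy u)) + D.supΩ (D.dr^[2] u)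

/-- `B₂(u) = max_{[0,R]} |u|_{3,∞,I}`. -/
def B2 (u : ℝ → ℝ → ℂ) : ℝ := D.maxSemiI 3 u

end Data

end CNFD

end

/-! Put `w = u_r - i(λ/q)u - δ y u_y` (`aux`). The equation says `Λ(r) w = iξu`, and the boundary
conditions on `u` force `w` to vanish at both ends. As `T_h Λ_h P_h w = P_h w`, the truncation error
is a local part plus `T_h` applied to a source (`IsSolution.truncationError_eq`). The local part
collects Taylor errors of quotients and averages of `u`. The source is the consistency error `Λ_h
P_h w - iξ P_h u` minus `iξ` times the error of the two-point average of `u`. It remains to bound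
`T_h` in the maximum norm uniformly in `J`, and to bound `w` up to its fourth derivative by third
derivatives of `u` only.

Stability (`disc_stable`) is an energy argument: pairing `Λ_h v` with `v` and using the real or the
imaginary part controls the discrete `L²` norm, then the discrete `H¹` seminorm, which dominates the
maximum norm in one dimension. The coercivity constant can be chosen independently of `J`
(`exists_coercive`) because the smallest eigenvalue of the discrete Dirichlet Laplacian increases
with `J`.

For the regularity of `w`, the equation `w'' = -(ζw + iξu)` reduces four derivatives of `w` to a
bound of `w` itself, obtained as the limit of the discrete stability bound (`elliptic_sup_le`), and
two derivatives of `u`. The latter are controlled by `u_yyy` because `u` has three homogeneous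
boundary conditions (`C2Bound.of_third`).

Differences of consecutive errors gain a factor `k`: `T_h` is Lipschitz in `r`
(`normInf_solH_sub_le`), `w(r) - w(r')` solves an elliptic problem with data of size `|r - r'|`
(`rhsDiff`), and two consecutive Taylor errors differ by the Taylor error of `f(t) - f(t - k)`. -/

namespace CNFD

/-! ### Discrete Poincaré–Friedrichs inequality and discrete stability -/

/-- Summation by parts for sequences vanishing at `0`. -/
lemma sum_conj_mul_secondDiff (v : ℕ → ℂ) (h0 : v 0 = 0) (K : ℕ) :
    ∑ i ∈ Finset.range K, (starRingEnd ℂ) (v (i + 1)) * (2 * v (i + 1) - v i - v (i + 2))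
      + (starRingEnd ℂ) (v (K + 1)) * (v (K + 1) - v K)
      = ((∑ j ∈ Finset.range (K + 1), ‖v (j + 1) - v j‖ ^ 2 : ℝ) : ℂ) := by
  induction K with
  | zero =>
    simp [h0, Complex.conj_mul']
  | succ K ih =>
    rw [Finset.sum_range_succ, Finset.sum_range_succ _ (K + 1), Complex.ofReal_add, ← ih]
    have := Complex.conj_mul' (v (K + 1 + 1) - v (K + 1))
    push_cast
    rw [← this]
    simp only [map_sub]
    ring

/-- Discrete Picone inequality: after replacing `a`, `b` by their moduli, the defect is the perfect
square `(‖b‖x - ‖a‖y)²/(xy)`. It is applied with `x`, `y` consecutive values of the positive ground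
state, the sine vector. -/
lemma picone_step (a b : ℂ) {x y : ℝ} (hx : 0 < x) (hy : 0 < y) :
    ‖b‖ ^ 2 * (1 - x / y) + ‖a‖ ^ 2 * (1 - y / x) ≤ ‖b - a‖ ^ 2 := by
  have h1 : (‖b‖ - ‖a‖) ^ 2 ≤ ‖b - a‖ ^ 2 := by
    rw [← sq_abs (‖b‖ - ‖a‖)]
    exact pow_le_pow_left₀ (abs_nonneg _) (abs_norm_sub_norm_le b a) 2
  have h2 : (‖b‖ - ‖a‖) ^ 2 - (‖b‖ ^ 2 * (1 - x / y) + ‖a‖ ^ 2 * (1 - y / x))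
      = (‖b‖ * x - ‖a‖ * y) ^ 2 / (x * y) := by
    field_simp; ring
  have h3 : 0 ≤ (‖b‖ * x - ‖a‖ * y) ^ 2 / (x * y) := by positivity
  linarith

/-- The smallest eigenvalue of the discrete Dirichlet Laplacian. -/
noncomputable def eigMin (J : ℕ) : ℝ := (J : ℝ) ^ 2 * (2 - 2 * Real.cos (Real.pi / J))

lemma sin_three_term (θ : ℝ) (n : ℕ) :
    Real.sin ((n + 2 : ℕ) * θ)
      = 2 * Real.cos θ * Real.sin ((n + 1 : ℕ) * θ) - Real.sin (n * θ) := by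
  have e1 : ((n + 2 : ℕ) : ℝ) * θ = ((n + 1 : ℕ) : ℝ) * θ + θ := by push_cast; ring
  have e2 : (n : ℝ) * θ = ((n + 1 : ℕ) : ℝ) * θ - θ := by push_cast; ring
  rw [e1, e2, Real.sin_add, Real.sin_sub]; ring

lemma sin_node_pos {J j : ℕ} (hj : 0 < j) (hJ : j < J) :
    0 < Real.sin ((j : ℝ) * (Real.pi / J)) := by
  have hJ' : (0 : ℝ) < J := by exact_mod_cast hj.trans hJ
  have hj' : (0 : ℝ) < j := by exact_mod_cast hj
  have hlt : (j : ℝ) < J := by exact_mod_cast hJ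
  apply Real.sin_pos_of_pos_of_lt_pi
  · have := Real.pi_pos
    positivity
  · rw [mul_div_assoc', div_lt_iff₀ hJ', mul_comm]
    exact mul_lt_mul_of_pos_left hlt Real.pi_pos

/-- `picone_step` is summed edge by edge. The two edges at an inner node contribute `2 - (s_{n} +
s_{n+2})/s_{n+1}`, which is the eigenvalue `2 - 2cos θ` by `sin_three_term`; the boundary term is
what the next edge has yet to complete. -/
lemma picone_partial (v : ℕ → ℂ) (h0 : v 0 = 0) {J n : ℕ} (hn : n + 1 < J) :
    (2 - 2 * Real.cos (Real.pi / J)) * ∑ i ∈ Finset.range n, ‖v (i + 1)‖ ^ 2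
      + ‖v (n + 1)‖ ^ 2 * (1 - Real.sin ((n : ℕ) * (Real.pi / J))
          / Real.sin ((n + 1 : ℕ) * (Real.pi / J)))
      ≤ ∑ j ∈ Finset.range (n + 1), ‖v (j + 1) - v j‖ ^ 2 := by
  induction n with
  | zero => simp [h0]
  | succ n ih =>
    have ih := ih (by omega)
    have h1 := sin_node_pos (J := J) (j := n + 1) (by omega) (by omega)
    have h2 := sin_node_pos (J := J) (j := n + 1 + 1) (by omega) (by omega)
    have h3 := picone_step (v (n + 1)) (v (n + 1 + 1)) h1 h2
    have h4 := sin_three_term (Real.pi / J) n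
    rw [Finset.sum_range_succ, Finset.sum_range_succ _ (n + 1)]
    have h5 : Real.sin ((n + 1 + 1 : ℕ) * (Real.pi / J)) / Real.sin ((n + 1 : ℕ) * (Real.pi / J))
        = 2 * Real.cos (Real.pi / J) - Real.sin ((n : ℕ) * (Real.pi / J))
          / Real.sin ((n + 1 : ℕ) * (Real.pi / J)) := by
      rw [h4, sub_div, mul_div_cancel_right₀ _ h1.ne']
    rw [h5] at h3
    linarith

/-- Discrete Poincaré–Friedrichs inequality with the optimal constant. -/
lemma eig_mul_sum_le (v : ℕ → ℂ) (h0 : v 0 = 0) {K : ℕ} (hK : 1 ≤ K) (hJ : v (K + 1) = 0) :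
    (2 - 2 * Real.cos (Real.pi / (K + 1 : ℕ))) * ∑ i ∈ Finset.range K, ‖v (i + 1)‖ ^ 2
      ≤ ∑ j ∈ Finset.range (K + 1), ‖v (j + 1) - v j‖ ^ 2 := by
  obtain ⟨n, rfl⟩ : ∃ n, K = n + 1 := ⟨K - 1, by omega⟩
  have h := picone_partial v h0 (J := n + 1 + 1) (n := n) (by omega)
  have h1 := sin_node_pos (J := n + 1 + 1) (j := n + 1) (by omega) (by omega)
  have h4 := sin_three_term (Real.pi / (n + 1 + 1 : ℕ)) n
  -- On the last edge the sine weight is zero, so `picone_step` does not apply; instead `v` vanishes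
  -- at the end point and the edge contributes exactly the missing `‖v‖²`.
  have h5 : Real.sin ((n + 2 : ℕ) * (Real.pi / (n + 1 + 1 : ℕ))) = 0 := by
    rw [mul_div_cancel₀]
    · exact Real.sin_pi
    · positivity
  rw [h5] at h4
  have h6 : Real.sin ((n : ℕ) * (Real.pi / (n + 1 + 1 : ℕ)))
      / Real.sin ((n + 1 : ℕ) * (Real.pi / (n + 1 + 1 : ℕ)))
      = 2 * Real.cos (Real.pi / (n + 1 + 1 : ℕ)) := by
    rw [div_eq_iff h1.ne']; linarith
  rw [h6] at h
  rw [Finset.sum_range_succ, Finset.sum_range_succ _ (n + 1), hJ, zero_sub, norm_neg]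
  linarith

lemma eigMin_eq (J : ℕ) : eigMin J = (2 * J * Real.sin (Real.pi / (2 * J))) ^ 2 := by
  have h : Real.pi / J = 2 * (Real.pi / (2 * J)) := by
    by_cases hJ : (J : ℝ) = 0
    · simp [hJ]
    · field_simp
  rw [eigMin, h, Real.cos_two_mul, Real.cos_sq']
  ring

lemma mul_sin_le {x y : ℝ} (hx : 0 < x) (hxy : x ≤ y) (hy : y ≤ Real.pi) :
    x * Real.sin y ≤ y * Real.sin x := by
  have hy0 : 0 < y := hx.trans_le hxy
  have h1 : 0 ≤ 1 - x / y := by rw [sub_nonneg, div_le_one hy0]; exact hxy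
  have h0 : 0 ≤ x / y := by positivity
  have h := strictConcaveOn_sin_Icc.concaveOn.2 (show y ∈ Icc 0 Real.pi from ⟨hy0.le, hy⟩)
    (show (0 : ℝ) ∈ Icc 0 Real.pi from ⟨le_rfl, Real.pi_pos.le⟩) h0 h1 (by ring)
  simp only [smul_eq_mul, Real.sin_zero, mul_zero, add_zero, div_mul_cancel₀ _ hy0.ne'] at h
  rw [div_mul_eq_mul_div, div_le_iff₀ hy0] at h
  linarith

/-- By `eigMin_eq` the square root is `π sin x / x` at `x = π/(2J)`, and `sin x / x` decreases on
`(0, π]` by concavity. -/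
lemma eigMin_mono {J J' : ℕ} (hJ : 1 ≤ J) (h : J ≤ J') : eigMin J ≤ eigMin J' := by
  have h1 : (1 : ℝ) ≤ J := by exact_mod_cast hJ
  have h2 : (J : ℝ) ≤ J' := by exact_mod_cast h
  have hpi := Real.pi_pos
  have hJ0 : (0 : ℝ) < J := by linarith
  have hJ0' : (0 : ℝ) < J' := by linarith
  have hle : Real.pi / (2 * J') ≤ Real.pi / (2 * J) := by gcongr
  have hpi2 : Real.pi / (2 * J) ≤ Real.pi := div_le_self hpi.le (by linarith)
  have h3 := mul_sin_le (x := Real.pi / (2 * J')) (y := Real.pi / (2 * J)) (by positivity) hle hpi2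
  have h0 : 0 ≤ Real.sin (Real.pi / (2 * J)) :=
    Real.sin_nonneg_of_nonneg_of_le_pi (by positivity) hpi2
  rw [eigMin_eq, eigMin_eq]
  apply pow_le_pow_left₀ (by positivity)
  rw [div_mul_eq_mul_div, div_mul_eq_mul_div, div_le_div_iff₀ (by positivity) (by positivity)] at h3
  have h4 : Real.pi * (2 * J * Real.sin (Real.pi / (2 * J)))
      ≤ Real.pi * (2 * J' * Real.sin (Real.pi / (2 * J'))) := by linarith
  exact le_of_mul_le_mul_left h4 hpi

lemma eigMin_pos {J : ℕ} (hJ : 2 ≤ J) : 0 < eigMin J := by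
  rw [eigMin_eq]
  have h1 : (2 : ℝ) ≤ J := by exact_mod_cast hJ
  have : 0 < Real.sin (Real.pi / (2 * J)) := by
    apply Real.sin_pos_of_pos_of_lt_pi
    · have := Real.pi_pos
      positivity
    · exact div_lt_self Real.pi_pos (by linarith)
  positivity

lemma sum_Ioo_eq_range {M : Type*} [AddCommMonoid M] (f : ℕ → M) (K : ℕ) :
    ∑ j ∈ Finset.Ioo 0 (K + 1), f j = ∑ i ∈ Finset.range K, f (i + 1) := by
  rw [Finset.range_eq_Ico, Finset.sum_Ico_add' f 0 K 1]
  rfl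

lemma mesh_pos {J : ℕ} (hJ : 1 ≤ J) : 0 < mesh J := by
  have : (0 : ℝ) < J := by exact_mod_cast hJ
  unfold mesh; positivity

lemma norm0_sq {K : ℕ} (v : Xh (K + 1)) :
    norm0 v ^ 2 = mesh (K + 1) * ∑ i ∈ Finset.range K, ‖v.1 (i + 1)‖ ^ 2 := by
  have := (mesh_pos (J := K + 1) (by omega)).le
  rw [norm0, Real.sq_sqrt (by positivity), sum_Ioo_eq_range]

lemma semi1_sq {J : ℕ} (hJ : 1 ≤ J) (v : Xh J) :
    semi1 v ^ 2 = J * ∑ j ∈ Finset.range J, ‖v.1 (j + 1) - v.1 j‖ ^ 2 := by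
  have hm := mesh_pos hJ
  have hJ' : (0 : ℝ) < J := by exact_mod_cast hJ
  rw [semi1, Real.sq_sqrt (by positivity), Finset.mul_sum, Finset.mul_sum]
  refine Finset.sum_congr rfl fun j _ => ?_
  rw [norm_div, Complex.norm_real, Real.norm_of_nonneg hm.le, mesh]
  field_simp

/-- The discrete sine vector. -/
noncomputable def sineVec (J : ℕ) : Xh J :=
  ofInterior J fun j => ((Real.sin ((j : ℝ) * (Real.pi / J)) : ℝ) : ℂ)

lemma sineVec_apply {J j : ℕ} (hJ : 1 ≤ J) (hj : j ≤ J) :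
    (sineVec J).1 j = ((Real.sin ((j : ℝ) * (Real.pi / J)) : ℝ) : ℂ) := by
  have hJ' : (J : ℝ) ≠ 0 := by positivity
  rcases Nat.eq_zero_or_pos j with rfl | h0
  · simp [sineVec, ofInterior]
  rcases hj.lt_or_eq with h | rfl
  · simp [sineVec, ofInterior, h, h0]
  · simp [sineVec, ofInterior, mul_div_cancel₀ _ hJ']

/-- The sine vector is an eigenvector of the second difference, so summation by parts turns its
energy into the eigenvalue times its norm. It is the test function that bounds the optimal constant
from below. -/
lemma sineVec_norms {J : ℕ} (hJ : 2 ≤ J) :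
    0 < norm0 (sineVec J) ∧ semi1 (sineVec J) ^ 2 = eigMin J * norm0 (sineVec J) ^ 2 := by
  obtain ⟨K, rfl⟩ : ∃ K, J = K + 1 := ⟨J - 1, by omega⟩
  have hap := fun j (hj : j ≤ K + 1) => sineVec_apply (J := K + 1) (j := j) (by omega) hj
  constructor
  · have hm := mesh_pos (J := K + 1) (by omega)
    rw [norm0, sum_Ioo_eq_range]
    apply Real.sqrt_pos.2
    refine mul_pos hm (Finset.sum_pos (fun i hi => ?_) ⟨0, by simp; omega⟩)
    have hi := Finset.mem_range.1 hi
    rw [hap _ (by omega), Complex.norm_real]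
    have := sin_node_pos (J := K + 1) (j := i + 1) (by omega) (by omega)
    exact pow_pos (norm_pos_iff.2 this.ne') 2
  · rw [norm0_sq, semi1_sq (by omega)]
    have hs := sum_conj_mul_secondDiff (sineVec (K + 1)).1 (sineVec (K + 1)).2.1 K
    rw [(sineVec (K + 1)).2.2 (K + 1) le_rfl] at hs
    have h1 : ∑ i ∈ Finset.range K, (starRingEnd ℂ) ((sineVec (K + 1)).1 (i + 1)) *
        (2 * (sineVec (K + 1)).1 (i + 1) - (sineVec (K + 1)).1 i - (sineVec (K + 1)).1 (i + 2))
        = (((2 - 2 * Real.cos (Real.pi / (K + 1 : ℕ))) *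
          ∑ i ∈ Finset.range K, ‖(sineVec (K + 1)).1 (i + 1)‖ ^ 2 : ℝ) : ℂ) := by
      rw [Finset.mul_sum, Complex.ofReal_sum]
      refine Finset.sum_congr rfl fun i hi => ?_
      have hi := Finset.mem_range.1 hi
      rw [hap (i + 1) (by omega), hap i (by omega), hap (i + 2) (by omega), sin_three_term,
        Complex.conj_ofReal, Complex.norm_real, Real.norm_eq_abs, sq_abs]
      push_cast
      ring
    rw [h1, map_zero, zero_mul, add_zero, Complex.ofReal_inj] at hs
    rw [← hs, eigMin, mesh]
    have : ((K + 1 : ℕ) : ℝ) ≠ 0 := by positivity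
    field_simp

lemma poincare {J : ℕ} (hJ : 2 ≤ J) (v : Xh J) :
    eigMin J * norm0 v ^ 2 ≤ semi1 v ^ 2 := by
  obtain ⟨K, rfl⟩ : ∃ K, J = K + 1 := ⟨J - 1, by omega⟩
  have h := eig_mul_sum_le v.1 v.2.1 (K := K) (by omega) (v.2.2 _ le_rfl)
  rw [norm0_sq, semi1_sq (by omega)]
  have h2 := mul_le_mul_of_nonneg_left h (show (0 : ℝ) ≤ (K + 1 : ℕ) by positivity)
  refine le_trans (le_of_eq ?_) h2
  have : ((K + 1 : ℕ) : ℝ) ≠ 0 := by positivity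
  rw [eigMin, mesh]
  field_simp

/-- Only this half of the equality is needed: it turns the hypothesis on the optimal constant into
one on `eigMin`, whose dependence on `J` is explicit. -/
lemma inv_discretePF_sq_le {J : ℕ} (hJ : 2 ≤ J) : 1 / discretePF J ^ 2 ≤ eigMin J := by
  have hμ := eigMin_pos hJ
  -- Without an admissible constant the infimum would have the default value `0`; `poincare`
  -- supplies one.
  have hne : {c : ℝ | 0 ≤ c ∧ ∀ v : Xh J, norm0 v ≤ c * semi1 v}.Nonempty := by
    refine ⟨1 / Real.sqrt (eigMin J), by positivity, fun v => ?_⟩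
    have hs : 0 ≤ semi1 v := Real.sqrt_nonneg _
    refine (sq_le_sq₀ (Real.sqrt_nonneg _) (by positivity)).1 ?_
    rw [mul_pow, div_pow, Real.sq_sqrt hμ.le, one_pow, one_div_mul_eq_div, le_div_iff₀ hμ, mul_comm]
    exact poincare hJ v
  have hle : 1 / Real.sqrt (eigMin J) ≤ discretePF J := by
    refine le_csInf hne ?_
    rintro c ⟨hc, h⟩
    obtain ⟨h1, h2⟩ := sineVec_norms hJ
    have h3 := pow_le_pow_left₀ h1.le (h (sineVec J)) 2
    rw [mul_pow, h2] at h3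
    have h4 : 1 ≤ c ^ 2 * eigMin J := by
      have : 0 < norm0 (sineVec J) ^ 2 := by positivity
      nlinarith
    rw [div_le_iff₀ (Real.sqrt_pos.2 hμ)]
    refine (sq_le_sq₀ (by positivity) (by positivity)).1 ?_
    rw [mul_pow, Real.sq_sqrt hμ.le]; simpa using h4
  have h5 := pow_le_pow_left₀ (by positivity) hle 2
  rw [div_pow, Real.sq_sqrt hμ.le, one_pow] at h5
  have := one_div_le_one_div_of_le (by positivity) h5
  simpa using this

end CNFD

/-! ### Energy estimate and maximum-norm stability of the discrete operator -/

namespace CNFD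

/-- The stability constant in the maximum norm. -/
noncomputable def stabConst (c Z : ℝ) : ℝ := 1 / c + Z / c ^ 2 + 1

lemma stabConst_pos {c Z : ℝ} (hc : 0 < c) (hZ : 0 ≤ Z) : 0 < stabConst c Z := by
  unfold stabConst; positivity

lemma norm_sum_conj_mul_le {K : ℕ} {F : ℝ} (v f : ℕ → ℂ)
    (hf : ∀ i < K, ‖f (i + 1)‖ ≤ F) :
    ‖∑ i ∈ Finset.range K, (starRingEnd ℂ) (v (i + 1)) * f (i + 1)‖ ^ 2
      ≤ F ^ 2 * (K * ∑ i ∈ Finset.range K, ‖v (i + 1)‖ ^ 2) := by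
  have h1 : ‖∑ i ∈ Finset.range K, (starRingEnd ℂ) (v (i + 1)) * f (i + 1)‖
      ≤ F * ∑ i ∈ Finset.range K, ‖v (i + 1)‖ := by
    rw [Finset.mul_sum]
    refine (norm_sum_le _ _).trans (Finset.sum_le_sum fun i hi => ?_)
    rw [norm_mul, RCLike.norm_conj, mul_comm]
    exact mul_le_mul_of_nonneg_right (hf i (Finset.mem_range.1 hi)) (norm_nonneg _)
  have h2 := sq_sum_le_card_mul_sum_sq (s := Finset.range K) (f := fun i => ‖v (i + 1)‖)
  rw [Finset.card_range] at h2
  refine (pow_le_pow_left₀ (norm_nonneg _) h1 2).trans ?_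
  rw [mul_pow]
  exact mul_le_mul_of_nonneg_left h2 (by positivity)

/-- One-dimensional discrete Sobolev inequality: telescoping from the zero boundary value, then
Cauchy–Schwarz. -/
lemma norm_sq_le_card_mul_sum (v : ℕ → ℂ) (h0 : v 0 = 0) {j J : ℕ} (hj : j ≤ J) :
    ‖v j‖ ^ 2 ≤ J * ∑ i ∈ Finset.range J, ‖v (i + 1) - v i‖ ^ 2 := by
  have h1 : ‖v j‖ ≤ ∑ i ∈ Finset.range J, ‖v (i + 1) - v i‖ := by
    have := Finset.sum_range_sub v j
    rw [h0, sub_zero] at this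
    rw [← this]
    refine (norm_sum_le _ _).trans ?_
    exact Finset.sum_le_sum_of_subset_of_nonneg (by simpa using hj) fun _ _ _ => norm_nonneg _
  have h2 := sq_sum_le_card_mul_sum_sq (s := Finset.range J) (f := fun i => ‖v (i + 1) - v i‖)
  rw [Finset.card_range] at h2
  exact (pow_le_pow_left₀ (norm_nonneg _) h1 2).trans h2

/-- Either the real part or the imaginary part of the coefficient `a` makes the discrete
operator `-Δ_h - a` coercive. -/
def Coercive (c : ℝ) (J : ℕ) (a : ℝ → ℂ) : Prop :=
  (∀ y ∈ Icc (0 : ℝ) 1, c ≤ eigMin J - (a y).re) ∨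
    ∃ d : ℝ, |d| = 1 ∧ ∀ y ∈ Icc (0 : ℝ) 1, c ≤ d * (a y).im

lemma Coercive.mono {c : ℝ} {J J' : ℕ} {a : ℝ → ℂ} (h : Coercive c J a) (hJ : 1 ≤ J)
    (hJJ : J ≤ J') : Coercive c J' a := by
  rcases h with h | h
  · exact Or.inl fun y hy => (h y hy).trans (sub_le_sub_right (eigMin_mono hJ hJJ) _)
  · exact Or.inr h

lemma node_mem {J j : ℕ} (hj : j ≤ J) : node J j ∈ Icc (0 : ℝ) 1 := by
  have : (j : ℝ) ≤ J := by exact_mod_cast hj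
  refine ⟨by unfold node mesh; positivity, ?_⟩
  rw [node, mesh, mul_one_div]
  exact div_le_one_of_le₀ this (by positivity)

/-- The discrete elliptic operator `-Δ_h - a` at the index `j`. -/
noncomputable def discOp (J : ℕ) (a : ℝ → ℂ) (v : ℕ → ℂ) (j : ℕ) : ℂ :=
  -((v (j - 1) - 2 * v j + v (j + 1)) / (mesh J : ℂ) ^ 2) - a (node J j) * v j

lemma energy_identity {K : ℕ} (a : ℝ → ℂ) (v : ℕ → ℂ) (h0 : v 0 = 0) (hJ : v (K + 1) = 0) :
    ∑ i ∈ Finset.range K, (starRingEnd ℂ) (v (i + 1)) * discOp (K + 1) a v (i + 1)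
      = ((((K + 1 : ℕ) : ℝ) ^ 2 * ∑ j ∈ Finset.range (K + 1), ‖v (j + 1) - v j‖ ^ 2 : ℝ) : ℂ)
        - ∑ i ∈ Finset.range K, a (node (K + 1) (i + 1)) * ((‖v (i + 1)‖ ^ 2 : ℝ) : ℂ) := by
  have hs := sum_conj_mul_secondDiff v h0 K
  rw [hJ, map_zero, zero_mul, add_zero] at hs
  rw [Complex.ofReal_mul, ← hs, Finset.mul_sum, ← Finset.sum_sub_distrib]
  refine Finset.sum_congr rfl fun i _ => ?_
  have h := Complex.conj_mul' (v (i + 1))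
  rw [Complex.ofReal_pow ‖v (i + 1)‖, ← h, discOp, mesh]
  have : ((K + 1 : ℕ) : ℂ) ≠ 0 := by exact_mod_cast Nat.succ_ne_zero K
  simp only [Nat.add_sub_cancel]
  push_cast at this ⊢
  field_simp
  ring

/-- The difference part of `energy_identity` is real. It therefore disappears from the imaginary
part, while in the real part it is bounded below by `eigMin` times the norm. -/
lemma coercive_bound {K : ℕ} (hK : 1 ≤ K) {c : ℝ} {a : ℝ → ℂ} (hc : Coercive c (K + 1) a)
    (v : ℕ → ℂ) (h0 : v 0 = 0) (hJ : v (K + 1) = 0) :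
    c * ∑ i ∈ Finset.range K, ‖v (i + 1)‖ ^ 2
      ≤ ‖∑ i ∈ Finset.range K, (starRingEnd ℂ) (v (i + 1)) * discOp (K + 1) a v (i + 1)‖ := by
  have he := energy_identity a v h0 hJ
  have hn : ∀ i ∈ Finset.range K, node (K + 1) (i + 1) ∈ Icc (0 : ℝ) 1 := fun i hi =>
    node_mem (by have := Finset.mem_range.1 hi; omega)
  rcases hc with hc | ⟨d, hd, hc⟩
  · refine le_trans ?_ (Complex.re_le_norm _)
    rw [he, Complex.sub_re, Complex.ofReal_re, Complex.re_sum]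
    have h1 := eig_mul_sum_le v h0 hK hJ
    have h2 := mul_le_mul_of_nonneg_left h1 (show (0 : ℝ) ≤ ((K + 1 : ℕ) : ℝ) ^ 2 by positivity)
    rw [← mul_assoc] at h2
    change eigMin (K + 1) * _ ≤ _ at h2
    refine le_trans ?_ (sub_le_sub_right h2 _)
    rw [Finset.mul_sum, Finset.mul_sum, ← Finset.sum_sub_distrib]
    refine Finset.sum_le_sum fun i hi => ?_
    rw [Complex.re_mul_ofReal, ← sub_mul]
    exact mul_le_mul_of_nonneg_right (hc _ (hn i hi)) (by positivity)
  · have h1 := Complex.abs_im_le_norm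
      (∑ i ∈ Finset.range K, (starRingEnd ℂ) (v (i + 1)) * discOp (K + 1) a v (i + 1))
    refine le_trans ?_ h1
    rw [← one_mul (|_|), ← hd, ← abs_mul]
    refine le_trans ?_ (neg_le_abs _)
    rw [he, Complex.sub_im, Complex.ofReal_im, Complex.im_sum, zero_sub, mul_neg, neg_neg,
      Finset.mul_sum, Finset.mul_sum]
    refine Finset.sum_le_sum fun i hi => ?_
    rw [Complex.im_mul_ofReal, ← mul_assoc]
    exact mul_le_mul_of_nonneg_right (hc _ (hn i hi)) (by positivity)

/-- Stability of the discrete elliptic operator in the maximum norm. -/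
lemma disc_stable {J : ℕ} (hJ2 : 2 ≤ J) {c Z F : ℝ} (hc : 0 < c) (hF : 0 ≤ F) {a : ℝ → ℂ}
    (ha : ∀ y ∈ Icc (0 : ℝ) 1, ‖a y‖ ≤ Z) (hcoer : Coercive c J a)
    (v : ℕ → ℂ) (h0 : v 0 = 0) (hJ : v J = 0)
    (hf : ∀ j, 0 < j → j < J → ‖discOp J a v j‖ ≤ F) {j : ℕ} (hj : j ≤ J) :
    ‖v j‖ ≤ stabConst c Z * F := by
  obtain ⟨K, rfl⟩ : ∃ K, J = K + 1 := ⟨J - 1, by omega⟩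
  have hZ : 0 ≤ Z := (norm_nonneg _).trans (ha 0 (by simp))
  have hf' : ∀ i < K, ‖discOp (K + 1) a v (i + 1)‖ ≤ F := fun i hi =>
    hf _ (by omega) (by omega)
  set N0 : ℝ := ∑ i ∈ Finset.range K, ‖v (i + 1)‖ ^ 2 with hN0
  set N1 : ℝ := ∑ j ∈ Finset.range (K + 1), ‖v (j + 1) - v j‖ ^ 2 with hN1
  set S : ℂ := ∑ i ∈ Finset.range K, (starRingEnd ℂ) (v (i + 1)) * discOp (K + 1) a v (i + 1)
    with hS
  have hN0n : 0 ≤ N0 := Finset.sum_nonneg fun _ _ => by positivity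
  have hS1 : c * N0 ≤ ‖S‖ := coercive_bound (by omega) hcoer v h0 hJ
  have hS2 : ‖S‖ ^ 2 ≤ F ^ 2 * (K * N0) := norm_sum_conj_mul_le v _ hf'
  have hKJ : (K : ℝ) ≤ (K + 1 : ℕ) := by push_cast; linarith
  set L : ℝ := ((K + 1 : ℕ) : ℝ) with hL
  have hLpos : 0 < L := by positivity
  have hS2' : ‖S‖ ^ 2 ≤ F ^ 2 * (L * N0) := hS2.trans (by gcongr)
  -- Coercivity and Cauchy–Schwarz give `‖S‖² ≤ F²L‖S‖/c`, and one factor `‖S‖` is cancelled. The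
  -- sums are not weighted by the mesh width; the powers of `L = J` cancel in `h5`, which makes the
  -- final bound independent of `J`.
  have hS3 : ‖S‖ ≤ F ^ 2 * L / c := by
    rw [le_div_iff₀ hc]
    rcases (norm_nonneg S).eq_or_lt with h | h
    · rw [← h]; simp; positivity
    · have h3 : ‖S‖ * (‖S‖ * c) ≤ ‖S‖ * (F ^ 2 * L) := by
        calc ‖S‖ * (‖S‖ * c) = ‖S‖ ^ 2 * c := by ring
          _ ≤ F ^ 2 * (L * N0) * c := by gcongr
          _ = F ^ 2 * L * (c * N0) := by ring
          _ ≤ F ^ 2 * L * ‖S‖ := by gcongr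
          _ = _ := by ring
      exact le_of_mul_le_mul_left h3 h
  have hN0' : N0 ≤ F ^ 2 * L / c ^ 2 := by
    rw [le_div_iff₀ (by positivity)]
    have := hS1.trans hS3
    rw [le_div_iff₀ hc] at this
    linarith
  have hE : L ^ 2 * N1 ≤ ‖S‖ + Z * N0 := by
    have he : ((L ^ 2 * N1 : ℝ) : ℂ) = S
        + ∑ i ∈ Finset.range K, a (node (K + 1) (i + 1)) * ((‖v (i + 1)‖ ^ 2 : ℝ) : ℂ) := by
      rw [hS, energy_identity a v h0 hJ]; ring
    have hn := congrArg norm he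
    rw [Complex.norm_real, Real.norm_of_nonneg (by positivity)] at hn
    rw [hn]
    refine (norm_add_le _ _).trans (add_le_add_right ?_ _)
    rw [hN0, Finset.mul_sum]
    refine (norm_sum_le _ _).trans (Finset.sum_le_sum fun i hi => ?_)
    rw [norm_mul, Complex.norm_real, Real.norm_of_nonneg (by positivity)]
    exact mul_le_mul_of_nonneg_right
      (ha _ (node_mem (by have := Finset.mem_range.1 hi; omega))) (by positivity)
  have hv : ‖v j‖ ^ 2 ≤ L * N1 := norm_sq_le_card_mul_sum v h0 hj
  have h5 : L * ‖v j‖ ^ 2 ≤ L * ((1 / c + Z / c ^ 2) * F ^ 2) := by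
    calc L * ‖v j‖ ^ 2 ≤ L * (L * N1) := by gcongr
      _ = L ^ 2 * N1 := by ring
      _ ≤ ‖S‖ + Z * N0 := hE
      _ ≤ F ^ 2 * L / c + Z * (F ^ 2 * L / c ^ 2) := by gcongr
      _ = _ := by ring
  have h6 := le_of_mul_le_mul_left h5 hLpos
  have hx : 0 ≤ 1 / c + Z / c ^ 2 := by positivity
  refine (sq_le_sq₀ (norm_nonneg _) (mul_nonneg (stabConst_pos hc hZ).le hF)).1 (h6.trans ?_)
  rw [mul_pow]
  refine mul_le_mul_of_nonneg_right ?_ (by positivity)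
  unfold stabConst
  -- The summand `1` in `stabConst` replaces a square root: `x ≤ (x + 1)²` for `x ≥ 0`.
  nlinarith

end CNFD

namespace CNFD

/-! ### Calculus on compact intervals -/

/-- `f'` is the (one-sided at the end points) derivative of `f` on `[a,b]`. -/
def DerivOn (a b : ℝ) (f f' : ℝ → ℂ) : Prop :=
  ∀ t ∈ Icc a b, HasDerivWithinAt f (f' t) (Icc a b) t

lemma DerivOn.mono {a b a' b' : ℝ} {f f' : ℝ → ℂ} (h : DerivOn a b f f') (ha : a ≤ a')
    (hb : b' ≤ b) : DerivOn a' b' f f' := fun t ht =>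
  (h t ⟨ha.trans ht.1, ht.2.trans hb⟩).mono (Icc_subset_Icc ha hb)

lemma DerivOn.continuousOn {a b : ℝ} {f f' : ℝ → ℂ} (h : DerivOn a b f f') :
    ContinuousOn f (Icc a b) := fun t ht => (h t ht).continuousWithinAt

lemma DerivOn.add {a b : ℝ} {f f' g g' : ℝ → ℂ} (hf : DerivOn a b f f') (hg : DerivOn a b g g') :
    DerivOn a b (fun t => f t + g t) (fun t => f' t + g' t) :=
  fun t ht => (hf t ht).add (hg t ht)

lemma DerivOn.sub {a b : ℝ} {f f' g g' : ℝ → ℂ} (hf : DerivOn a b f f') (hg : DerivOn a b g g') :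
    DerivOn a b (fun t => f t - g t) (fun t => f' t - g' t) :=
  fun t ht => (hf t ht).sub (hg t ht)

lemma DerivOn.const_mul {a b : ℝ} {f f' : ℝ → ℂ} (c : ℂ) (hf : DerivOn a b f f') :
    DerivOn a b (fun t => c * f t) (fun t => c * f' t) :=
  fun t ht => (hf t ht).const_mul c

lemma DerivOn.neg {a b : ℝ} {f f' : ℝ → ℂ} (hf : DerivOn a b f f') :
    DerivOn a b (fun t => -f t) (fun t => -f' t) :=
  fun t ht => (hf t ht).neg

lemma DerivOn.mul {a b : ℝ} {f f' g g' : ℝ → ℂ} (hf : DerivOn a b f f') (hg : DerivOn a b g g') :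
    DerivOn a b (fun t => f t * g t) (fun t => f' t * g t + f t * g' t) :=
  fun t ht => (hf t ht).mul (hg t ht)

lemma DerivOn.comp_affine {a b a' b' : ℝ} {f f' : ℝ → ℂ} (hf : DerivOn a b f f') (c σ : ℝ)
    (hmap : ∀ t ∈ Icc a' b', c + σ * t ∈ Icc a b) :
    DerivOn a' b' (fun t => f (c + σ * t)) (fun t => σ * f' (c + σ * t)) := fun t ht => by
  have h1 : HasDerivWithinAt (fun t : ℝ => c + σ * t) σ (Icc a' b') t := by
    simpa using ((hasDerivWithinAt_id t (Icc a' b')).const_mul σ).const_add c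
  have h2 := (hf _ (hmap t ht)).scomp t h1 hmap
  simpa [Function.comp_def] using h2

lemma DerivOn.norm_sub_le {a b M : ℝ} {f f' : ℝ → ℂ} (h : DerivOn a b f f')
    (hM : ∀ t ∈ Icc a b, ‖f' t‖ ≤ M) {x y : ℝ} (hx : x ∈ Icc a b) (hy : y ∈ Icc a b) :
    ‖f y - f x‖ ≤ M * |y - x| := by
  simpa using (convex_Icc a b).norm_image_sub_le_of_norm_hasDerivWithin_le h hM hx hy

/-- Integration of a power bound, without the factor `1/(m+1)`. The symmetric Taylor remainders
below are obtained by iterating it: the derivative in `t` of each remainder is the preceding one for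
`f'`. -/
lemma DerivOn.norm_le_pow {T M : ℝ} {f f' : ℝ → ℂ} (h : DerivOn 0 T f f') (h0 : f 0 = 0) {m : ℕ}
    (hM : ∀ t ∈ Icc 0 T, ‖f' t‖ ≤ M * t ^ m) (hM0 : 0 ≤ M) {t : ℝ} (ht : t ∈ Icc 0 T) :
    ‖f t‖ ≤ M * t ^ (m + 1) := by
  have h1 := (h.mono le_rfl ht.2).norm_sub_le (M := M * t ^ m) (fun s hs => by
    refine (hM s ⟨hs.1, hs.2.trans ht.2⟩).trans ?_
    have := pow_le_pow_left₀ hs.1 hs.2 m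
    gcongr) (x := 0) (y := t) ⟨le_rfl, ht.1⟩ ⟨ht.1, le_rfl⟩
  rw [h0, sub_zero, sub_zero, abs_of_nonneg ht.1] at h1
  rw [pow_succ, ← mul_assoc]; exact h1

section CentralDifferences

variable {a b c T M : ℝ} {f f1 f2 f3 f4 : ℝ → ℂ}

lemma DerivOn.comp_add (hf : DerivOn a b f f1) (ha : a ≤ c) (hb : c + T ≤ b) :
    DerivOn 0 T (fun t => f (c + t)) (fun t => f1 (c + t)) := by
  have := hf.comp_affine (a' := 0) (b' := T) c 1
    (fun t ht => ⟨by linarith [ht.1], by linarith [ht.2]⟩)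
  simpa using this

lemma DerivOn.comp_sub (hf : DerivOn a b f f1) (ha : a ≤ c - T) (hb : c ≤ b) :
    DerivOn 0 T (fun t => f (c - t)) (fun t => -f1 (c - t)) := by
  have := hf.comp_affine (a' := 0) (b' := T) c (-1)
    (fun t ht => ⟨by linarith [ht.2], by linarith [ht.1]⟩)
  simpa [← sub_eq_add_neg] using this

lemma DerivOn.norm_symm_sub_le (hf : DerivOn a b f f1) (hM : ∀ t ∈ Icc a b, ‖f1 t‖ ≤ M)
    (ha : a ≤ c - T) (hb : c + T ≤ b) {t : ℝ} (ht : t ∈ Icc 0 T) :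
    ‖f (c + t) - f (c - t)‖ ≤ 2 * M * t := by
  have h := hf.norm_sub_le hM (x := c - t) (y := c + t)
    ⟨by linarith [ht.2, ht.1], by linarith [ht.2, ht.1]⟩
    ⟨by linarith [ht.2, ht.1], by linarith [ht.2, ht.1]⟩
  rw [show c + t - (c - t) = 2 * t by ring, abs_of_nonneg (by linarith [ht.1])] at h
  linarith

lemma DerivOn.norm_secondDiff_le (hf : DerivOn a b f f1) (hf1 : DerivOn a b f1 f2)
    (hM : ∀ t ∈ Icc a b, ‖f2 t‖ ≤ M) (ha : a ≤ c - T) (hb : c + T ≤ b) {t : ℝ}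
    (ht : t ∈ Icc 0 T) : ‖f (c + t) + f (c - t) - 2 * f c‖ ≤ 2 * M * t ^ 2 := by
  have hT : 0 ≤ T := ht.1.trans ht.2
  have hM0 : 0 ≤ M := (norm_nonneg _).trans (hM a ⟨le_rfl, by linarith⟩)
  have hd : DerivOn 0 T (fun t => f (c + t) + f (c - t) - 2 * f c)
      (fun t => f1 (c + t) - f1 (c - t)) := fun s hs => by
    have := ((hf.comp_add (T := T) (by linarith) hb).add (hf.comp_sub ha (by linarith)) s hs)
    simpa [sub_eq_add_neg] using this.sub_const (2 * f c)
  refine hd.norm_le_pow (m := 1) (by simp; ring) (fun s hs => ?_) (by positivity) ht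
  rw [pow_one]
  exact hf1.norm_symm_sub_le hM ha hb hs

lemma DerivOn.norm_central_sub_le (hf : DerivOn a b f f1) (hf1 : DerivOn a b f1 f2)
    (hf2 : DerivOn a b f2 f3)
    (hM : ∀ t ∈ Icc a b, ‖f3 t‖ ≤ M) (ha : a ≤ c - T) (hb : c + T ≤ b) {t : ℝ}
    (ht : t ∈ Icc 0 T) : ‖f (c + t) - f (c - t) - 2 * t * f1 c‖ ≤ 2 * M * t ^ 3 := by
  have hT : 0 ≤ T := ht.1.trans ht.2
  have hM0 : 0 ≤ M := (norm_nonneg _).trans (hM a ⟨le_rfl, by linarith⟩)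
  have hd : DerivOn 0 T (fun t => f (c + t) - f (c - t) - 2 * t * f1 c)
      (fun t => f1 (c + t) + f1 (c - t) - 2 * f1 c) := fun s hs => by
    have h1 := ((hf.comp_add (T := T) (by linarith) hb).sub (hf.comp_sub ha (by linarith)) s hs)
    have h2 : HasDerivWithinAt (fun t : ℝ => 2 * (t : ℂ) * f1 c) (2 * f1 c) (Icc 0 T) s := by
      have := (((hasDerivAt_id s).ofReal_comp.const_mul (2 : ℂ)).mul_const (f1 c)).hasDerivWithinAt
        (s := Icc 0 T)
      simpa using this
    simpa [sub_eq_add_neg] using h1.fun_sub h2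
  refine hd.norm_le_pow (m := 2) (by simp) (fun s hs => ?_) (by positivity) ht
  exact hf1.norm_secondDiff_le hf2 hM ha hb hs

lemma DerivOn.norm_secondDiff_sub_le (hf : DerivOn a b f f1) (hf1 : DerivOn a b f1 f2)
    (hf2 : DerivOn a b f2 f3) (hf3 : DerivOn a b f3 f4)
    (hM : ∀ t ∈ Icc a b, ‖f4 t‖ ≤ M) (ha : a ≤ c - T) (hb : c + T ≤ b) {t : ℝ}
    (ht : t ∈ Icc 0 T) :
    ‖f (c + t) + f (c - t) - 2 * f c - t ^ 2 * f2 c‖ ≤ 2 * M * t ^ 4 := by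
  have hT : 0 ≤ T := ht.1.trans ht.2
  have hM0 : 0 ≤ M := (norm_nonneg _).trans (hM a ⟨le_rfl, by linarith⟩)
  have hd : DerivOn 0 T (fun t => f (c + t) + f (c - t) - 2 * f c - t ^ 2 * f2 c)
      (fun t => f1 (c + t) - f1 (c - t) - 2 * t * f2 c) := fun s hs => by
    have h1 := ((hf.comp_add (T := T) (by linarith) hb).add (hf.comp_sub ha (by linarith)) s hs)
    have h2 : HasDerivWithinAt (fun t : ℝ => (t : ℂ) ^ 2 * f2 c) (2 * s * f2 c) (Icc 0 T) s := by
      have := (((hasDerivAt_id s).ofReal_comp.pow 2).mul_const (f2 c)).hasDerivWithinAt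
        (s := Icc 0 T)
      simpa using this
    simpa [sub_eq_add_neg] using (h1.sub_const (2 * f c)).fun_sub h2
  refine hd.norm_le_pow (m := 3) (by simp; ring) (fun s hs => ?_) (by positivity) ht
  exact hf1.norm_central_sub_le hf2 hf3 hM ha hb hs

end CentralDifferences

/-- `f` is twice differentiable on `[0,1]` and `f`, `f'`, `f''` are bounded by `M`. -/
def C2Bound (f : ℝ → ℂ) (M : ℝ) : Prop :=
  ∃ f1 f2 : ℝ → ℂ, DerivOn 0 1 f f1 ∧ DerivOn 0 1 f1 f2 ∧
    ∀ y ∈ Icc (0 : ℝ) 1, ‖f y‖ ≤ M ∧ ‖f1 y‖ ≤ M ∧ ‖f2 y‖ ≤ M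

namespace C2Bound

variable {f g : ℝ → ℂ} {M N : ℝ}

lemma nonneg (hf : C2Bound f M) : 0 ≤ M := by
  obtain ⟨f1, f2, -, -, h⟩ := hf
  exact (norm_nonneg _).trans (h 0 (by simp)).1

lemma norm_le (hf : C2Bound f M) {y : ℝ} (hy : y ∈ Icc (0 : ℝ) 1) : ‖f y‖ ≤ M := by
  obtain ⟨f1, f2, -, -, h⟩ := hf
  exact (h y hy).1

lemma mono (hf : C2Bound f M) (h : M ≤ N) : C2Bound f N := by
  obtain ⟨f1, f2, h1, h2, h3⟩ := hf
  exact ⟨f1, f2, h1, h2, fun y hy =>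
    ⟨(h3 y hy).1.trans h, (h3 y hy).2.1.trans h, (h3 y hy).2.2.trans h⟩⟩

lemma add (hf : C2Bound f M) (hg : C2Bound g N) : C2Bound (fun y => f y + g y) (M + N) := by
  obtain ⟨f1, f2, h1, h2, h3⟩ := hf
  obtain ⟨g1, g2, k1, k2, k3⟩ := hg
  exact ⟨_, _, h1.add k1, h2.add k2, fun y hy => ⟨norm_add_le_of_le (h3 y hy).1 (k3 y hy).1,
    norm_add_le_of_le (h3 y hy).2.1 (k3 y hy).2.1, norm_add_le_of_le (h3 y hy).2.2 (k3 y hy).2.2⟩⟩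

lemma neg (hf : C2Bound f M) : C2Bound (fun y => -f y) M := by
  obtain ⟨f1, f2, h1, h2, h3⟩ := hf
  exact ⟨_, _, h1.neg, h2.neg, fun y hy => by simpa using h3 y hy⟩

lemma const_mul (c : ℂ) (hf : C2Bound f M) : C2Bound (fun y => c * f y) (‖c‖ * M) := by
  obtain ⟨f1, f2, h1, h2, h3⟩ := hf
  refine ⟨_, _, h1.const_mul c, h2.const_mul c, fun y hy => ?_⟩
  simp only [norm_mul]
  exact ⟨mul_le_mul_of_nonneg_left (h3 y hy).1 (norm_nonneg _),
    mul_le_mul_of_nonneg_left (h3 y hy).2.1 (norm_nonneg _),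
    mul_le_mul_of_nonneg_left (h3 y hy).2.2 (norm_nonneg _)⟩

lemma mul (hf : C2Bound f M) (hg : C2Bound g N) : C2Bound (fun y => f y * g y) (4 * (M * N)) := by
  have hM := hf.nonneg
  have hN := hg.nonneg
  obtain ⟨f1, f2, h1, h2, h3⟩ := hf
  obtain ⟨g1, g2, k1, k2, k3⟩ := hg
  refine ⟨_, _, h1.mul k1, (h2.mul k1).add (h1.mul k2), fun y hy => ?_⟩
  have hp : 0 ≤ M * N := by positivity
  obtain ⟨a0, a1, a2⟩ := h3 y hy
  obtain ⟨b0, b1, b2⟩ := k3 y hy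
  have key : ∀ {x z : ℂ}, ‖x‖ ≤ M → ‖z‖ ≤ N → ‖x * z‖ ≤ M * N := fun hx hz => by
    rw [norm_mul]; exact mul_le_mul hx hz (norm_nonneg _) hM
  refine ⟨(key a0 b0).trans (by linarith),
    (norm_add_le_of_le (key a1 b0) (key a0 b1)).trans (by linarith),
    (norm_add_le_of_le (norm_add_le_of_le (key a2 b0) (key a1 b1))
      (norm_add_le_of_le (key a1 b1) (key a0 b2))).trans (by linarith)⟩

end C2Bound

lemma exists_norm_le_of_continuousOn {f : ℝ → ℂ} {a b : ℝ} (hf : ContinuousOn f (Icc a b)) :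
    ∃ M, 0 ≤ M ∧ ∀ y ∈ Icc a b, ‖f y‖ ≤ M := by
  obtain ⟨M, hM⟩ := isCompact_Icc.exists_bound_of_continuousOn hf
  exact ⟨max M 0, le_max_right _ _, fun y hy => (hM y hy).trans (le_max_left _ _)⟩

lemma DerivOn.norm_le_of_zero {f f1 : ℝ → ℂ} {M x y : ℝ} (h : DerivOn 0 1 f f1)
    (hM : ∀ y ∈ Icc (0 : ℝ) 1, ‖f1 y‖ ≤ M) (hx : x ∈ Icc (0 : ℝ) 1) (h0 : f x = 0)
    (hy : y ∈ Icc (0 : ℝ) 1) : ‖f y‖ ≤ M := by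
  have h1 := h.norm_sub_le hM hx hy
  have hM0 : 0 ≤ M := (norm_nonneg _).trans (hM x hx)
  rw [h0, sub_zero] at h1
  refine h1.trans (mul_le_of_le_one_right hM0 ?_)
  rw [abs_le]
  exact ⟨by linarith [hx.2, hy.1], by linarith [hx.1, hy.2]⟩

/-- A function with zero values at both end points has its first derivative controlled by the
second one. -/
lemma C2Bound.of_zero_bdry {f f1 f2 : ℝ → ℂ} {M N : ℝ} (h1 : DerivOn 0 1 f f1)
    (h2 : DerivOn 0 1 f1 f2) (hf : ∀ y ∈ Icc (0 : ℝ) 1, ‖f y‖ ≤ N)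
    (hM : ∀ y ∈ Icc (0 : ℝ) 1, ‖f2 y‖ ≤ M) (h0 : f 0 = 0) (hf1 : f 1 = 0) :
    C2Bound f (N + 2 * M) := by
  have hM0 : 0 ≤ M := (norm_nonneg _).trans (hM 0 (by simp))
  have hN0 : 0 ≤ N := (norm_nonneg _).trans (hf 0 (by simp))
  have hlin : DerivOn 0 1 (fun y => f y - y * f1 0) (fun y => f1 y - f1 0) := fun y hy => by
    have := ((hasDerivAt_id y).ofReal_comp.mul_const (f1 0)).hasDerivWithinAt (s := Icc 0 1)
    simpa using (h1 y hy).fun_sub this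
  have hd : ∀ y ∈ Icc (0 : ℝ) 1, ‖f1 y - f1 0‖ ≤ M := fun y hy => by
    have := h2.norm_sub_le hM (x := 0) (by simp) hy
    refine this.trans (mul_le_of_le_one_right hM0 ?_)
    rw [sub_zero, abs_of_nonneg hy.1]; exact hy.2
  -- At `y = 1` the remainder `f(y) - y f'(0)` equals `-f'(0)`, so `‖f'(0)‖ ≤ M`, and `f'` varies by
  -- at most `M`.
  have h3 := hlin.norm_le_of_zero hd (x := 0) (y := 1) (by simp) (by simp [h0]) (by simp)
  simp only [hf1, Complex.ofReal_one, one_mul, zero_sub, norm_neg] at h3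
  refine ⟨f1, f2, h1, h2, fun y hy => ⟨(hf y hy).trans (by linarith), ?_,
    (hM y hy).trans (by linarith)⟩⟩
  have := norm_add_le_of_le (hd y hy) h3
  rw [sub_add_cancel] at this
  linarith

/-- Control by the third derivative under the conditions `u(0) = u(1) = u'(1) = 0`. -/
lemma C2Bound.of_third {u u1 u2 u3 : ℝ → ℂ} {M : ℝ} (h1 : DerivOn 0 1 u u1)
    (h2 : DerivOn 0 1 u1 u2) (h3 : DerivOn 0 1 u2 u3) (hM : ∀ y ∈ Icc (0 : ℝ) 1, ‖u3 y‖ ≤ M)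
    (hu0 : u 0 = 0) (hu1 : u 1 = 0) (hu1' : u1 1 = 0) : C2Bound u (3 * M) := by
  have hM0 : 0 ≤ M := (norm_nonneg _).trans (hM 0 (by simp))
  have d2 : DerivOn 0 1 (fun y => u2 y - u2 1) u3 := fun y hy => (h3 y hy).sub_const _
  have b2 : ∀ y ∈ Icc (0 : ℝ) 1, ‖u2 y - u2 1‖ ≤ M := fun y hy =>
    d2.norm_le_of_zero hM (x := 1) (by simp) (by simp) hy
  have d1 : DerivOn 0 1 (fun y => u1 y - (y - 1) * u2 1) (fun y => u2 y - u2 1) := fun y hy => by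
    have := ((((hasDerivAt_id y).ofReal_comp.sub_const 1).mul_const (u2 1)).hasDerivWithinAt
      (s := Icc 0 1))
    simpa using (h2 y hy).fun_sub this
  have b1 : ∀ y ∈ Icc (0 : ℝ) 1, ‖u1 y - (y - 1) * u2 1‖ ≤ M := fun y hy =>
    d1.norm_le_of_zero b2 (x := 1) (by simp) (by simp [hu1']) hy
  have d0 : DerivOn 0 1 (fun y => u y - (y - 1) ^ 2 / 2 * u2 1)
      (fun y => u1 y - (y - 1) * u2 1) := fun y hy => by
    have h := (((((hasDerivAt_id y).ofReal_comp.sub_const 1).fun_pow 2).div_const 2).mul_const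
      (u2 1)).hasDerivWithinAt (s := Icc 0 1)
    have := (h1 y hy).fun_sub h
    simpa using this
  have b0 : ∀ y ∈ Icc (0 : ℝ) 1, ‖u y - (y - 1) ^ 2 / 2 * u2 1‖ ≤ M := fun y hy =>
    d0.norm_le_of_zero b1 (x := 1) (by simp) (by simp [hu1]) hy
  -- Subtracting `(y-1)²/2 · u''(1)` removes the second-order Taylor polynomial at `1`. The
  -- remaining condition `u(0) = 0` bounds its only unknown coefficient.
  have e : ‖u2 1‖ ≤ 2 * M := by
    have h := b0 0 (by simp)
    rw [hu0] at h
    simp only [Complex.ofReal_zero, zero_sub, norm_neg, norm_mul] at h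
    norm_num at h
    linarith
  refine ⟨u1, u2, h1, h2, fun y hy => ?_⟩
  have hy1 : ‖(y : ℂ) - 1‖ ≤ 1 := by
    rw [← Complex.ofReal_one, ← Complex.ofReal_sub, Complex.norm_real, Real.norm_eq_abs, abs_le]
    exact ⟨by linarith [hy.1], by linarith [hy.2]⟩
  have a2 : ‖u2 y‖ ≤ 3 * M := by
    have := norm_add_le_of_le (b2 y hy) e
    rw [sub_add_cancel] at this
    linarith
  have a1 : ‖u1 y‖ ≤ 3 * M := by
    have e' : ‖((y : ℂ) - 1) * u2 1‖ ≤ 2 * M := by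
      rw [norm_mul]
      exact (mul_le_of_le_one_left (norm_nonneg _) hy1).trans e
    have := norm_add_le_of_le (b1 y hy) e'
    rw [sub_add_cancel] at this
    linarith
  have a1' : ∀ y ∈ Icc (0 : ℝ) 1, ‖u1 y‖ ≤ 3 * M := fun y hy =>
    h2.norm_le_of_zero (M := 3 * M) (fun y hy => by
      have := norm_add_le_of_le (b2 y hy) e
      rw [sub_add_cancel] at this
      linarith) (x := 1) (by simp) hu1' hy
  exact ⟨h1.norm_le_of_zero a1' (x := 0) (by simp) hu0 hy, a1, a2⟩

end CNFD

namespace CNFD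

/-! ### Elliptic estimates -/

lemma node_succ (J j : ℕ) : node J (j + 1) = node J j + mesh J := by
  unfold node; push_cast; ring

lemma node_pred {J j : ℕ} (hj : 0 < j) : node J (j - 1) = node J j - mesh J := by
  obtain ⟨i, rfl⟩ : ∃ i, j = i + 1 := ⟨j - 1, by omega⟩
  rw [node_succ]; simp

lemma node_self {J : ℕ} (hJ : 1 ≤ J) : node J J = 1 := by
  have : (J : ℝ) ≠ 0 := by positivity
  rw [node, mesh]; field_simp

lemma mesh_le_node {J j : ℕ} (hj : 0 < j) (hJ : j < J) :
    0 ≤ node J j - mesh J ∧ node J j + mesh J ≤ 1 := by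
  rw [← node_pred hj, ← node_succ]
  exact ⟨(node_mem (by omega)).1, (node_mem (by omega)).2⟩

/-- Consistency of the second-order difference quotient. -/
lemma norm_discOp_sub_le {a z z1 z2 : ℝ → ℂ} {M : ℝ} (h1 : DerivOn 0 1 z z1)
    (h2 : DerivOn 0 1 z1 z2) (h3 : C2Bound z2 M) {J j : ℕ} (hj : 0 < j) (hJ : j < J) :
    ‖discOp J a (fun i => z (node J i)) j - (-z2 (node J j) - a (node J j) * z (node J j))‖
      ≤ 2 * M * mesh J ^ 2 := by
  obtain ⟨z3, z4, h4, h5, h6⟩ := h3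
  have hm := mesh_pos (J := J) (by omega)
  obtain ⟨e1, e2⟩ := mesh_le_node hj hJ
  have h := h1.norm_secondDiff_sub_le h2 h4 h5 (M := M) (fun t ht => (h6 t ht).2.2) e1 e2
    (t := mesh J) ⟨hm.le, le_rfl⟩
  have hmc : (mesh J : ℂ) ≠ 0 := by exact_mod_cast hm.ne'
  have e : discOp J a (fun i => z (node J i)) j
      - (-z2 (node J j) - a (node J j) * z (node J j))
      = -(z (node J j + mesh J) + z (node J j - mesh J) - 2 * z (node J j)
          - (mesh J : ℂ) ^ 2 * z2 (node J j)) / (mesh J : ℂ) ^ 2 := by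
    simp only [discOp, node_succ, node_pred hj]
    field_simp
    ring
  rw [e, norm_div, norm_neg, norm_pow, Complex.norm_real, Real.norm_of_nonneg hm.le,
    div_le_iff₀ (by positivity)]
  refine h.trans (le_of_eq ?_)
  ring

lemma tendsto_node_floor {y : ℝ} (hy : y ∈ Icc (0 : ℝ) 1) :
    Filter.Tendsto (fun J : ℕ => node J ⌊y * J⌋₊) Filter.atTop (nhdsWithin y (Icc 0 1)) := by
  refine tendsto_nhdsWithin_of_tendsto_nhds_of_eventually_within _ ?_ ?_
  · have := (tendsto_nat_floor_mul_div_atTop (R := ℝ) hy.1).comp tendsto_natCast_atTop_atTop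
    refine this.congr fun J => ?_
    simp [node, mesh, div_eq_mul_inv]
  · refine Filter.Eventually.of_forall fun J => node_mem ?_
    refine Nat.floor_le_of_le ?_
    exact mul_le_of_le_one_left (by positivity) hy.2

lemma tendsto_mesh : Filter.Tendsto mesh Filter.atTop (nhds 0) := by
  unfold mesh
  exact tendsto_one_div_atTop_nhds_zero_nat

/-- Maximum norm bound for the continuous elliptic problem, obtained as the limit of the discrete
stability bound. -/
lemma elliptic_sup_le {J : ℕ} (hJ2 : 2 ≤ J) {c Z G : ℝ} (hc : 0 < c) {a g z z1 : ℝ → ℂ}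
    (hcoer : Coercive c J a) (ha : C2Bound a Z) (hg : C2Bound g G) (h1 : DerivOn 0 1 z z1)
    (h2 : DerivOn 0 1 z1 fun y => -(a y * z y + g y)) (hz0 : z 0 = 0) (hz1 : z 1 = 0)
    {y : ℝ} (hy : y ∈ Icc (0 : ℝ) 1) : ‖z y‖ ≤ stabConst c Z * G := by
  -- This `M` is merely finite. It enters only through the consistency error, multiplied by `mesh J'
  -- ^ 2`, and disappears in the limit.
  have hqual : ∃ M, C2Bound z M := by
    obtain ⟨N, hN0, hN⟩ := exists_norm_le_of_continuousOn h1.continuousOn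
    refine ⟨_, C2Bound.of_zero_bdry (M := Z * N + G) h1 h2 hN (fun y hy => ?_) hz0 hz1⟩
    rw [norm_neg]
    refine norm_add_le_of_le ?_ (hg.norm_le hy)
    rw [norm_mul]
    exact mul_le_mul (ha.norm_le hy) (hN y hy) (norm_nonneg _) ha.nonneg
  obtain ⟨M, hM⟩ := hqual
  have hz2 := ((ha.mul hM).add hg).neg
  set M2 := 4 * (Z * M) + G with hM2
  -- Coercivity on the grid `J` persists on every finer grid, so `stabConst c Z` serves for all
  -- `J'`. The node with index `⌊y J'⌋` tends to `y`.
  have key : ∀ J' : ℕ, J ≤ J' →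
      ‖z (node J' ⌊y * J'⌋₊)‖ ≤ stabConst c Z * (G + 2 * M2 * mesh J' ^ 2) := fun J' hJJ => by
    have hM20 := hz2.nonneg
    have hG := hg.nonneg
    refine disc_stable (hJ2.trans hJJ) hc (by positivity) (fun y hy => ha.norm_le hy)
      (hcoer.mono (by omega) hJJ) (fun i => z (node J' i)) ?_ ?_ (fun j hj hjJ => ?_) ?_
    · simpa [node] using hz0
    · simpa [node_self (show 1 ≤ J' by omega)] using hz1
    · have h3 := norm_discOp_sub_le (a := a) h1 h2 hz2 hj hjJ
      have h4 := norm_add_le_of_le h3 (hg.norm_le (node_mem hjJ.le))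
      rw [show ∀ A B C D : ℂ, A - (-(-(B + C)) - B) + C = A from fun A B C D => by ring] at h4
      · linarith
      · exact 0
    · refine Nat.floor_le_of_le ?_
      exact mul_le_of_le_one_left (by positivity) hy.2
  have hlim1 : Filter.Tendsto (fun J' : ℕ => ‖z (node J' ⌊y * J'⌋₊)‖) Filter.atTop
      (nhds ‖z y‖) :=
    ((h1.continuousOn y hy).tendsto.comp (tendsto_node_floor hy)).norm
  have hlim2 : Filter.Tendsto (fun J' : ℕ => stabConst c Z * (G + 2 * M2 * mesh J' ^ 2))
      Filter.atTop (nhds (stabConst c Z * G)) := by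
    have := (((tendsto_mesh.pow 2).const_mul (2 * M2)).const_add G).const_mul (stabConst c Z)
    simpa using this
  exact le_of_tendsto_of_tendsto hlim1 hlim2
    ((Filter.eventually_ge_atTop J).mono key)

/-- Regularity constant for the solution of the elliptic problem. -/
noncomputable def ellConst (c Z : ℝ) : ℝ := stabConst c Z + 2 * (Z * stabConst c Z + 1)

/-- Regularity constant for the second derivative of the solution of the elliptic problem. -/
noncomputable def ellConst' (c Z : ℝ) : ℝ := 4 * (Z * ellConst c Z) + 1

lemma ellConst_pos {c Z : ℝ} (hc : 0 < c) (hZ : 0 ≤ Z) : 0 < ellConst c Z := by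
  have := stabConst_pos hc hZ
  unfold ellConst; positivity

lemma ellConst'_pos {c Z : ℝ} (hc : 0 < c) (hZ : 0 ≤ Z) : 0 < ellConst' c Z := by
  have := ellConst_pos hc hZ
  unfold ellConst'; positivity

/-- The second bound controls the fourth derivative of `z`, as `norm_discOp_sub_le` requires; it is
read off from the right-hand side of the equation, so no fourth derivative of `z` is assumed. -/
lemma elliptic_regularity {J : ℕ} (hJ2 : 2 ≤ J) {c Z G : ℝ} (hc : 0 < c) {a g z z1 : ℝ → ℂ}
    (hcoer : Coercive c J a) (ha : C2Bound a Z) (hg : C2Bound g G) (h1 : DerivOn 0 1 z z1)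
    (h2 : DerivOn 0 1 z1 fun y => -(a y * z y + g y)) (hz0 : z 0 = 0) (hz1 : z 1 = 0) :
    C2Bound z (ellConst c Z * G) ∧ C2Bound (fun y => -(a y * z y + g y)) (ellConst' c Z * G) := by
  have hz : C2Bound z (ellConst c Z * G) := by
    refine (C2Bound.of_zero_bdry (N := stabConst c Z * G) (M := Z * (stabConst c Z * G) + G) h1 h2
      (fun y hy => elliptic_sup_le hJ2 hc hcoer ha hg h1 h2 hz0 hz1 hy) (fun y hy => ?_)
      hz0 hz1).mono (le_of_eq (by unfold ellConst; ring))
    rw [norm_neg]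
    refine norm_add_le_of_le ?_ (hg.norm_le hy)
    rw [norm_mul]
    exact mul_le_mul (ha.norm_le hy) (elliptic_sup_le hJ2 hc hcoer ha hg h1 h2 hz0 hz1 hy)
      (norm_nonneg _) ha.nonneg
  exact ⟨hz, ((ha.mul hz).add hg).neg.mono (le_of_eq (by unfold ellConst'; ring))⟩

end CNFD

namespace CNFD

/-! ### Partial derivatives on the strip -/

lemma dy_iterate (n : ℕ) (f : ℝ → ℝ → ℂ) (r : ℝ) :
    dy^[n] f r = iteratedDerivWithin n (f r) (Icc 0 1) := by
  induction n with
  | zero => simp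
  | succ n ih =>
    funext y
    rw [Function.iterate_succ_apply', iteratedDerivWithin_succ, ← ih]
    rfl

lemma DerivOn.of_contDiffOn {a b : ℝ} {f : ℝ → ℂ} (hf : ContDiffOn ℝ 1 f (Icc a b)) :
    DerivOn a b f (derivWithin f (Icc a b)) := fun t ht =>
  ((hf.differentiableOn one_ne_zero) t ht).hasDerivWithinAt

lemma lipschitz_of_contDiffOn {a b : ℝ} (hab : a < b) {f : ℝ → ℂ}
    (hf : ContDiffOn ℝ 1 f (Icc a b)) :
    ∃ B, 0 ≤ B ∧ (∀ t ∈ Icc a b, ‖f t‖ ≤ B) ∧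
      ∀ t ∈ Icc a b, ∀ t' ∈ Icc a b, ‖f t - f t'‖ ≤ B * |t - t'| := by
  obtain ⟨B1, hB1, h1⟩ := exists_norm_le_of_continuousOn hf.continuousOn
  obtain ⟨B2, hB2, h2⟩ := exists_norm_le_of_continuousOn
    (hf.continuousOn_derivWithin (uniqueDiffOn_Icc hab) le_rfl)
  refine ⟨B1 + B2, by positivity, fun t ht => (h1 t ht).trans (by linarith),
    fun t ht t' ht' => ?_⟩
  have := (DerivOn.of_contDiffOn hf).norm_sub_le h2 ht' ht
  refine this.trans ?_
  gcongr
  linarith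

namespace Data

variable (D : Data)

lemma uniqueDiffOn_Ω : UniqueDiffOn ℝ D.Ω :=
  (uniqueDiffOn_Icc D.R_pos).prod (uniqueDiffOn_Icc zero_lt_one)

variable {D} {f : ℝ → ℝ → ℂ}

lemma derivOn_fst {y : ℝ} (hf : ContDiffOn ℝ 1 (Function.uncurry f) D.Ω)
    (hy : y ∈ Icc (0 : ℝ) 1) : DerivOn 0 D.R (fun t => f t y) (fun t => D.dr f t y) := by
  refine DerivOn.of_contDiffOn ?_
  have h : ContDiffOn ℝ 1 (fun t : ℝ => (t, y)) (Icc 0 D.R) := by fun_prop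
  exact hf.comp h fun t ht => ⟨ht, hy⟩

lemma slice {r : ℝ} {n : WithTop ℕ∞} (hf : ContDiffOn ℝ n (Function.uncurry f) D.Ω)
    (hr : r ∈ Icc 0 D.R) : ContDiffOn ℝ n (f r) (Icc 0 1) := by
  have h : ContDiffOn ℝ n (fun t : ℝ => (r, t)) (Icc 0 1) := by fun_prop
  exact hf.comp h fun t ht => ⟨hr, ht⟩

lemma derivOn_snd {r : ℝ} (hf : ContDiffOn ℝ 1 (Function.uncurry f) D.Ω)
    (hr : r ∈ Icc 0 D.R) : DerivOn 0 1 (f r) (dy f r) :=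
  DerivOn.of_contDiffOn (slice hf hr)

/-- Writing the partial derivative as a directional Fréchet derivative within the strip transfers
joint smoothness to it, up to the boundary. -/
lemma dr_eq_fderivWithin (hf : ContDiffOn ℝ 1 (Function.uncurry f) D.Ω) {x : ℝ × ℝ}
    (hx : x ∈ D.Ω) :
    Function.uncurry (D.dr f) x = fderivWithin ℝ (Function.uncurry f) D.Ω x (1, 0) := by
  obtain ⟨r, y⟩ := x
  have h1 := ((hf.differentiableOn one_ne_zero) _ hx).hasFDerivWithinAt
  have h2 : HasDerivWithinAt (fun t : ℝ => (t, y)) ((1 : ℝ), (0 : ℝ)) (Icc 0 D.R) r :=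
    (hasDerivWithinAt_id r _).prodMk (hasDerivWithinAt_const r _ y)
  have hm : MapsTo (fun t : ℝ => (t, y)) (Icc 0 D.R) D.Ω := fun t ht => ⟨ht, hx.2⟩
  have h3 := h1.comp_hasDerivWithinAt r h2 hm
  exact h3.derivWithin (uniqueDiffOn_Icc D.R_pos r hx.1)

lemma dy_eq_fderivWithin (hf : ContDiffOn ℝ 1 (Function.uncurry f) D.Ω) {x : ℝ × ℝ}
    (hx : x ∈ D.Ω) :
    Function.uncurry (dy f) x = fderivWithin ℝ (Function.uncurry f) D.Ω x (0, 1) := by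
  obtain ⟨r, y⟩ := x
  have h1 := ((hf.differentiableOn one_ne_zero) _ hx).hasFDerivWithinAt
  have h2 : HasDerivWithinAt (fun t : ℝ => (r, t)) ((0 : ℝ), (1 : ℝ)) (Icc 0 1) y :=
    (hasDerivWithinAt_const y _ r).prodMk (hasDerivWithinAt_id y _)
  have hm : MapsTo (fun t : ℝ => (r, t)) (Icc 0 1) D.Ω := fun t ht => ⟨hx.1, ht⟩
  have h3 := h1.comp_hasDerivWithinAt y h2 hm
  exact h3.derivWithin (uniqueDiffOn_Icc zero_lt_one y hx.2)

lemma contDiffOn_dr {m : ℕ} (hf : ContDiffOn ℝ (m + 1 : ℕ) (Function.uncurry f) D.Ω) :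
    ContDiffOn ℝ m (Function.uncurry (D.dr f)) D.Ω :=
  ((hf.fderivWithin D.uniqueDiffOn_Ω (m := m) (by norm_cast)).clm_apply contDiffOn_const).congr
    fun _ hx => dr_eq_fderivWithin (hf.of_le (by norm_cast; omega)) hx

lemma contDiffOn_dy {m : ℕ} (hf : ContDiffOn ℝ (m + 1 : ℕ) (Function.uncurry f) D.Ω) :
    ContDiffOn ℝ m (Function.uncurry (dy f)) D.Ω :=
  ((hf.fderivWithin D.uniqueDiffOn_Ω (m := m) (by norm_cast)).clm_apply contDiffOn_const).congr
    fun _ hx => dy_eq_fderivWithin (hf.of_le (by norm_cast; omega)) hx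

lemma contDiffOn_dr_iterate {m n : ℕ}
    (hf : ContDiffOn ℝ (m + n : ℕ) (Function.uncurry f) D.Ω) :
    ContDiffOn ℝ m (Function.uncurry (D.dr^[n] f)) D.Ω := by
  induction n generalizing f with
  | zero => simpa using hf
  | succ n ih => exact ih (contDiffOn_dr hf)

lemma contDiffOn_dy_iterate {m n : ℕ}
    (hf : ContDiffOn ℝ (m + n : ℕ) (Function.uncurry f) D.Ω) :
    ContDiffOn ℝ m (Function.uncurry (dy^[n] f)) D.Ω := by
  induction n generalizing f with
  | zero => simpa using hf
  | succ n ih => exact ih (contDiffOn_dy hf)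

lemma derivOn_dr_iterate {m n : ℕ} {y : ℝ} (hn : n < m)
    (hf : ContDiffOn ℝ m (Function.uncurry f) D.Ω) (hy : y ∈ Icc (0 : ℝ) 1) :
    DerivOn 0 D.R (fun t => D.dr^[n] f t y) (fun t => D.dr^[n + 1] f t y) := by
  have h := derivOn_fst (y := y) ((contDiffOn_dr_iterate (m := 1) (n := n)
    (hf.of_le (by norm_cast; omega))).of_le (by norm_cast)) hy
  rwa [Function.iterate_succ']

lemma derivOn_dy_iterate {m n : ℕ} {r : ℝ} (hn : n < m)
    (hf : ContDiffOn ℝ m (Function.uncurry f) D.Ω) (hr : r ∈ Icc 0 D.R) :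
    DerivOn 0 1 (dy^[n] f r) (dy^[n + 1] f r) := by
  have h := derivOn_snd (r := r) ((contDiffOn_dy_iterate (m := 1) (n := n)
    (hf.of_le (by norm_cast; omega))).of_le (by norm_cast)) hr
  rwa [Function.iterate_succ']

lemma exists_bound (hf : ContinuousOn (Function.uncurry f) D.Ω) :
    ∃ B, 0 ≤ B ∧ ∀ r ∈ Icc 0 D.R, ∀ y ∈ Icc (0 : ℝ) 1, ‖f r y‖ ≤ B := by
  obtain ⟨B, hB⟩ := (isCompact_Icc.prod isCompact_Icc).exists_bound_of_continuousOn hf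
  exact ⟨max B 0, le_max_right _ _, fun r hr y hy =>
    (hB (r, y) ⟨hr, hy⟩).trans (le_max_left _ _)⟩

lemma supΩ_nonneg (f : ℝ → ℝ → ℂ) : 0 ≤ D.supΩ f :=
  Real.sSup_nonneg (by rintro _ ⟨x, -, rfl⟩; exact norm_nonneg _)

lemma semiI_nonneg (m : ℕ) (f : ℝ → ℂ) : 0 ≤ semiI m f :=
  Real.sSup_nonneg (by rintro _ ⟨x, -, rfl⟩; exact norm_nonneg _)

lemma maxSemiI_nonneg (m : ℕ) (f : ℝ → ℝ → ℂ) : 0 ≤ D.maxSemiI m f :=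
  Real.sSup_nonneg (by rintro _ ⟨x, -, rfl⟩; exact semiI_nonneg _ _)

/-- Continuity on the compact strip is what keeps the real supremum from being the default value of
an unbounded set. -/
lemma norm_le_supΩ (hf : ContinuousOn (Function.uncurry f) D.Ω) {r y : ℝ} (hr : r ∈ Icc 0 D.R)
    (hy : y ∈ Icc (0 : ℝ) 1) : ‖f r y‖ ≤ D.supΩ f := by
  obtain ⟨B, -, hB⟩ := exists_bound hf
  refine le_csSup ⟨B, ?_⟩ ⟨(r, y), ⟨hr, hy⟩, rfl⟩
  rintro _ ⟨x, hx, rfl⟩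
  exact hB _ hx.1 _ hx.2

lemma norm_le_maxSemiI {m : ℕ} (hf : ContinuousOn (Function.uncurry (dy^[m] f)) D.Ω) {r y : ℝ}
    (hr : r ∈ Icc 0 D.R) (hy : y ∈ Icc (0 : ℝ) 1) : ‖dy^[m] f r y‖ ≤ D.maxSemiI m f := by
  obtain ⟨B, hB0, hB⟩ := exists_bound hf
  have h1 : ∀ r ∈ Icc 0 D.R, semiI m (f r) ≤ B := fun r hr => by
    refine Real.sSup_le ?_ hB0
    rintro _ ⟨x, hx, rfl⟩
    have := hB r hr x hx
    rwa [dy_iterate] at this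
  have h2 : ‖dy^[m] f r y‖ ≤ semiI m (f r) := by
    rw [dy_iterate]
    refine le_csSup ⟨B, ?_⟩ ⟨y, hy, rfl⟩
    rintro _ ⟨x, hx, rfl⟩
    have := hB r hr x hx
    rwa [dy_iterate] at this
  refine h2.trans (le_csSup ⟨B, ?_⟩ ⟨r, hr, rfl⟩)
  rintro _ ⟨x, hx, rfl⟩
  exact h1 x hx

/-! ### Bounds of the coefficients -/

/-- Bounds and Lipschitz bounds, by the constant `Z`, of the coefficients of the problem. -/
structure CoefBound (D : Data) (Z : ℝ) : Prop where
  zeta : ∀ r ∈ Icc 0 D.R, C2Bound (D.ζ r) Z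
  zeta_sub : ∀ r ∈ Icc 0 D.R, ∀ r' ∈ Icc 0 D.R,
    C2Bound (fun y => D.ζ r y - D.ζ r' y) (Z * |r - r'|)
  xi : ∀ r ∈ Icc 0 D.R, ‖D.ξ r‖ ≤ Z
  xi_sub : ∀ r ∈ Icc 0 D.R, ∀ r' ∈ Icc 0 D.R, ‖D.ξ r - D.ξ r'‖ ≤ Z * |r - r'|
  delta : ∀ r ∈ Icc 0 D.R, ‖(D.δ r : ℂ)‖ ≤ Z
  delta_sub : ∀ r ∈ Icc 0 D.R, ∀ r' ∈ Icc 0 D.R, ‖(D.δ r : ℂ) - D.δ r'‖ ≤ Z * |r - r'|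
  lam : ‖D.lam / D.q‖ ≤ Z

lemma contDiffOn_zeta (D : Data) (n : ℕ) : ContDiffOn ℝ n (Function.uncurry D.ζ) D.Ω := by
  have hs : ContDiffOn ℝ n (fun x : ℝ × ℝ => (D.s x.1 : ℂ)) D.Ω :=
    Complex.ofRealCLM.contDiff.comp_contDiffOn
      ((D.s_smooth.of_le (by exact_mod_cast le_top)).comp contDiffOn_fst fun x hx => hx.1)
  have hγ : ContDiffOn ℝ n (fun x : ℝ × ℝ => D.γ x.1 x.2) D.Ω :=
    D.γ_smooth.of_le (by exact_mod_cast le_top)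
  exact (((contDiffOn_const.add (contDiffOn_const.mul hγ)).mul (hs.pow 2)).div_const _)

lemma contDiffOn_xi (D : Data) : ContDiffOn ℝ 1 D.ξ (Icc 0 D.R) := by
  have hs : ContDiffOn ℝ 1 (fun x : ℝ => (D.s x : ℂ)) (Icc 0 D.R) :=
    Complex.ofRealCLM.contDiff.comp_contDiffOn (D.s_smooth.of_le (by exact_mod_cast le_top))
  exact (contDiffOn_const.mul (hs.pow 2)).div_const _

lemma contDiffOn_delta (D : Data) : ContDiffOn ℝ 1 (fun r => (D.δ r : ℂ)) (Icc 0 D.R) := by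
  refine Complex.ofRealCLM.contDiff.comp_contDiffOn ?_
  refine ContDiffOn.div ?_ (D.s_smooth.of_le (by exact_mod_cast le_top))
    fun r hr => (D.s_pos r hr).ne'
  exact (D.s_smooth.derivWithin (uniqueDiffOn_Icc D.R_pos) (m := ∞) (by simp)).of_le
    (by exact_mod_cast le_top)

lemma zeta_bounds (D : Data) (i : ℕ) : ∃ B, 0 ≤ B ∧
    (∀ r ∈ Icc 0 D.R, ∀ y ∈ Icc (0 : ℝ) 1, ‖dy^[i] D.ζ r y‖ ≤ B) ∧
    ∀ r ∈ Icc 0 D.R, ∀ r' ∈ Icc 0 D.R, ∀ y ∈ Icc (0 : ℝ) 1,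
      ‖dy^[i] D.ζ r y - dy^[i] D.ζ r' y‖ ≤ B * |r - r'| := by
  have h : ContDiffOn ℝ (1 : ℕ) (Function.uncurry (dy^[i] D.ζ)) D.Ω :=
    contDiffOn_dy_iterate (D.contDiffOn_zeta _)
  obtain ⟨B1, hB1, h1⟩ := exists_bound h.continuousOn
  obtain ⟨B2, hB2, h2⟩ := exists_bound (contDiffOn_dr (m := 0) h).continuousOn
  refine ⟨B1 + B2, by positivity, fun r hr y hy => (h1 r hr y hy).trans (by linarith),
    fun r hr r' hr' y hy => ?_⟩
  have := (derivOn_fst (by exact_mod_cast h) hy).norm_sub_le (fun t ht => h2 t ht y hy) hr' hr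
  refine this.trans ?_
  gcongr
  linarith

lemma exists_coefBound (D : Data) : ∃ Z, 0 < Z ∧ D.CoefBound Z := by
  obtain ⟨B0, h0, a0, b0⟩ := zeta_bounds D 0
  obtain ⟨B1, h1, a1, b1⟩ := zeta_bounds D 1
  obtain ⟨B2, h2, a2, b2⟩ := zeta_bounds D 2
  obtain ⟨B3, h3, a3, b3⟩ := lipschitz_of_contDiffOn D.R_pos D.contDiffOn_xi
  obtain ⟨B4, h4, a4, b4⟩ := lipschitz_of_contDiffOn D.R_pos D.contDiffOn_delta
  have h5 := norm_nonneg (D.lam / D.q)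
  set Z := B0 + B1 + B2 + B3 + B4 + ‖D.lam / D.q‖ + 1 with hZ
  have l0 : B0 ≤ Z := by linarith
  have l1 : B1 ≤ Z := by linarith
  have l2 : B2 ≤ Z := by linarith
  have l3 : B3 ≤ Z := by linarith
  have l4 : B4 ≤ Z := by linarith
  have hlip : ∀ {B x t : ℝ}, x ≤ B * |t| → B ≤ Z → x ≤ Z * |t| := fun hx hB =>
    hx.trans (mul_le_mul_of_nonneg_right hB (abs_nonneg _))
  have d0 : ∀ r ∈ Icc 0 D.R, DerivOn 0 1 (D.ζ r) (dy^[1] D.ζ r) := fun r hr =>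
    derivOn_dy_iterate (m := 2) (n := 0) (by norm_num) (D.contDiffOn_zeta _) hr
  have d1 : ∀ r ∈ Icc 0 D.R, DerivOn 0 1 (dy^[1] D.ζ r) (dy^[2] D.ζ r) := fun r hr =>
    derivOn_dy_iterate (m := 2) (n := 1) (by norm_num) (D.contDiffOn_zeta _) hr
  refine ⟨Z, by positivity, ⟨fun r hr => ⟨_, _, d0 r hr, d1 r hr, fun y hy =>
    ⟨(a0 r hr y hy).trans l0, (a1 r hr y hy).trans l1, (a2 r hr y hy).trans l2⟩⟩,
    fun r hr r' hr' => ⟨_, _, (d0 r hr).sub (d0 r' hr'), (d1 r hr).sub (d1 r' hr'), fun y hy =>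
      ⟨hlip (b0 r hr r' hr' y hy) l0, hlip (b1 r hr r' hr' y hy) l1,
        hlip (b2 r hr r' hr' y hy) l2⟩⟩,
    fun r hr => (a3 r hr).trans l3, fun r hr r' hr' => hlip (b3 r hr r' hr') l3,
    fun r hr => (a4 r hr).trans l4, fun r hr r' hr' => hlip (b4 r hr r' hr') l4, by linarith⟩⟩

end Data

end CNFD

namespace CNFD

/-! ### The discrete maximum norm -/

section NormInf

variable {J : ℕ} {v w : Xh J}

lemma norm_le_normInf (v : Xh J) {j : ℕ} (hj : 0 < j) (hJ : j < J) : ‖v.1 j‖ ≤ normInf v := by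
  have h := Finset.le_sup (f := fun j => ‖v.1 j‖₊) (Finset.mem_Ioo.2 ⟨hj, hJ⟩)
  exact_mod_cast h

lemma normInf_le {c : ℝ} (hc : 0 ≤ c) (h : ∀ j, 0 < j → j < J → ‖v.1 j‖ ≤ c) :
    normInf v ≤ c := by
  lift c to NNReal using hc
  rw [normInf, NNReal.coe_le_coe]
  refine Finset.sup_le fun j hj => ?_
  obtain ⟨h1, h2⟩ := Finset.mem_Ioo.1 hj
  exact_mod_cast h j h1 h2

lemma normInf_nonneg (v : Xh J) : 0 ≤ normInf v := NNReal.coe_nonneg _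

lemma normInf_add_le (v w : Xh J) : normInf (v + w) ≤ normInf v + normInf w :=
  normInf_le (add_nonneg (normInf_nonneg _) (normInf_nonneg _)) fun _ hj hJ =>
    norm_add_le_of_le (norm_le_normInf v hj hJ) (norm_le_normInf w hj hJ)

end NormInf

instance (J : ℕ) : FiniteDimensional ℂ (Xh J) := by
  let φ : Xh J →ₗ[ℂ] (Fin J → ℂ) :=
    { toFun := fun v i => v.1 i
      map_add' := fun _ _ => rfl
      map_smul' := fun _ _ => rfl }
  refine FiniteDimensional.of_injective φ fun v w h => ?_
  ext j
  rcases lt_or_ge j J with hj | hj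
  · exact congrFun h ⟨j, hj⟩
  · rw [v.2.2 j hj, w.2.2 j hj]

lemma Xh.ext_interior {J : ℕ} {v w : Xh J} (h : ∀ j, 0 < j → j < J → v.1 j = w.1 j) : v = w := by
  ext j
  rcases Nat.eq_zero_or_pos j with rfl | h0
  · rw [v.2.1, w.2.1]
  rcases lt_or_ge j J with hj | hj
  · exact h j h0 hj
  · rw [v.2.2 j hj, w.2.2 j hj]

lemma ofInterior_apply {J : ℕ} (f : ℕ → ℂ) {j : ℕ} (hj : 0 < j) (hJ : j < J) :
    (ofInterior J f).1 j = f j := by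
  simp [ofInterior, hj, hJ]

lemma interp_apply {J : ℕ} (hJ : 1 ≤ J) {f : ℝ → ℂ} (h0 : f 0 = 0) (h1 : f 1 = 0) {j : ℕ}
    (hj : j ≤ J) : (interp J f).1 j = f (node J j) := by
  rcases Nat.eq_zero_or_pos j with rfl | hj0
  · simp [interp, ofInterior, node, h0]
  rcases hj.lt_or_eq with h | rfl
  · exact ofInterior_apply _ hj0 h
  · rw [node_self hJ, h1]; exact (interp j f).2.2 j le_rfl

/-! ### The discrete solution operator -/

namespace Data

variable {D : Data}

lemma ellipH_apply (J : ℕ) (r : ℝ) (v : Xh J) {j : ℕ} (hj : 0 < j) (hJ : j < J) :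
    (D.ellipH J r v).1 j = discOp J (D.ζ r) v.1 j := by
  simp [ellipH, laplacian, ofInterior, hj, hJ, discOp]

section Solution

variable {c Z : ℝ} {J : ℕ} {r r' : ℝ}

lemma normInf_le_ellipH (hZ : D.CoefBound Z) (hc : 0 < c) (hJ : 2 ≤ J) (hr : r ∈ Icc 0 D.R)
    (hcoer : Coercive c J (D.ζ r)) (v : Xh J) :
    normInf v ≤ stabConst c Z * normInf (D.ellipH J r v) := by
  have hK := stabConst_pos hc (hZ.zeta r hr).nonneg
  refine normInf_le (mul_nonneg hK.le (normInf_nonneg _)) fun j hj hjJ => ?_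
  refine disc_stable hJ hc (normInf_nonneg _) (fun y hy => (hZ.zeta r hr).norm_le hy) hcoer v.1
    v.2.1 (v.2.2 J le_rfl) (fun i hi hiJ => ?_) hjJ.le
  rw [← ellipH_apply J r v hi hiJ]
  exact norm_le_normInf _ hi hiJ

/-- Stability gives injectivity, which suffices in finite dimension. -/
lemma isUnit_ellipH (hZ : D.CoefBound Z) (hc : 0 < c) (hJ : 2 ≤ J) (hr : r ∈ Icc 0 D.R)
    (hcoer : Coercive c J (D.ζ r)) : IsUnit (D.ellipH J r) := by
  rw [LinearMap.isUnit_iff_ker_eq_bot, LinearMap.ker_eq_bot']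
  intro v hv
  have h := normInf_le_ellipH hZ hc hJ hr hcoer v
  have h0 : normInf (0 : Xh J) = 0 :=
    le_antisymm (normInf_le le_rfl fun j _ _ => by simp) (normInf_nonneg _)
  rw [hv, h0, mul_zero] at h
  refine Xh.ext_interior fun j hj hjJ => ?_
  simpa using (norm_le_normInf v hj hjJ).trans h

lemma solH_ellipH (hu : IsUnit (D.ellipH J r)) (v : Xh J) :
    D.solH J r (D.ellipH J r v) = v := by
  have := Ring.inverse_mul_cancel _ hu
  exact LinearMap.congr_fun this v

lemma ellipH_solH (hu : IsUnit (D.ellipH J r)) (v : Xh J) :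
    D.ellipH J r (D.solH J r v) = v := by
  have := Ring.mul_inverse_cancel _ hu
  exact LinearMap.congr_fun this v

lemma normInf_solH_le (hZ : D.CoefBound Z) (hc : 0 < c) (hJ : 2 ≤ J) (hr : r ∈ Icc 0 D.R)
    (hcoer : Coercive c J (D.ζ r)) (f : Xh J) :
    normInf (D.solH J r f) ≤ stabConst c Z * normInf f := by
  have h := normInf_le_ellipH hZ hc hJ hr hcoer (D.solH J r f)
  rwa [ellipH_solH (isUnit_ellipH hZ hc hJ hr hcoer)] at h

/-- Lipschitz dependence of the discrete solution operator on `r`. -/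
lemma normInf_solH_sub_le (hZ : D.CoefBound Z) (hc : 0 < c) (hJ : 2 ≤ J) (hr : r ∈ Icc 0 D.R)
    (hr' : r' ∈ Icc 0 D.R) (hcoer : Coercive c J (D.ζ r)) (hcoer' : Coercive c J (D.ζ r'))
    (f g : Xh J) :
    normInf (D.solH J r f - D.solH J r' g)
      ≤ stabConst c Z * (normInf (f - g)
        + Z * |r - r'| * (stabConst c Z * normInf g)) := by
  have hu := isUnit_ellipH hZ hc hJ hr hcoer
  have hu' := isUnit_ellipH hZ hc hJ hr' hcoer'
  have hZ0 := (hZ.zeta r hr).nonneg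
  have hK := stabConst_pos hc hZ0
  set v := D.solH J r' g with hv
  -- Second resolvent identity. The two discrete operators differ only by multiplication with
  -- `ζ(r,·) - ζ(r',·)`, so no power of the mesh width is lost.
  have e : D.solH J r f - v = D.solH J r ((f - g) + (g - D.ellipH J r v)) := by
    rw [← solH_ellipH hu v, ← map_sub, solH_ellipH hu v]
    congr 1; abel
  rw [e]
  refine (normInf_solH_le hZ hc hJ hr hcoer _).trans ?_
  refine mul_le_mul_of_nonneg_left ((normInf_add_le _ _).trans ?_) hK.le
  refine add_le_add_right ?_ _
  have hvn : normInf v ≤ stabConst c Z * normInf g := normInf_solH_le hZ hc hJ hr' hcoer' g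
  have hvn0 := normInf_nonneg v
  have hg0 := normInf_nonneg g
  refine normInf_le (by positivity) fun j hj hjJ => ?_
  have h1 : (g - D.ellipH J r v).1 j = (D.ζ r (node J j) - D.ζ r' (node J j)) * v.1 j := by
    have h2 : g = D.ellipH J r' v := (ellipH_solH hu' g).symm
    rw [h2]
    change (D.ellipH J r' v).1 j - (D.ellipH J r v).1 j = _
    rw [ellipH_apply J r' v hj hjJ, ellipH_apply J r v hj hjJ, discOp, discOp]
    ring
  rw [h1, norm_mul]
  exact mul_le_mul ((hZ.zeta_sub r hr r' hr').norm_le (node_mem hjJ.le))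
    ((norm_le_normInf v hj hjJ).trans hvn) (norm_nonneg _) (by positivity)

end Solution

/-! ### Uniform coercivity -/

lemma zeta_eq (D : Data) (r y : ℝ) :
    D.ζ r y = ((D.s r ^ 2 / D.α ^ 2 : ℝ) : ℂ) * (D.q⁻¹ + D.γ r y) := by
  have h1 : (D.α : ℂ) ≠ 0 := by exact_mod_cast D.α_pos.ne'
  have h2 := D.q_ne_zero
  rw [ζ]
  push_cast
  field_simp

lemma zeta_re (D : Data) (r y : ℝ) :
    (D.ζ r y).re = D.s r ^ 2 / (D.α ^ 2 * ‖D.q‖ ^ 2) * (D.q.re + ‖D.q‖ ^ 2 * (D.γ r y).re) := by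
  have h1 := D.α_pos.ne'
  have h2 : ‖D.q‖ ≠ 0 := norm_ne_zero_iff.2 D.q_ne_zero
  rw [zeta_eq, Complex.re_ofReal_mul, Complex.add_re, Complex.inv_re, Complex.normSq_eq_norm_sq]
  field_simp

lemma zeta_im (D : Data) (r y : ℝ) :
    (D.ζ r y).im
      = -(D.s r ^ 2 / (D.α ^ 2 * ‖D.q‖ ^ 2) * (D.q.im - ‖D.q‖ ^ 2 * (D.γ r y).im)) := by
  have h1 := D.α_pos.ne'
  have h2 : ‖D.q‖ ≠ 0 := norm_ne_zero_iff.2 D.q_ne_zero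
  rw [zeta_eq, Complex.im_ofReal_mul, Complex.add_im, Complex.inv_im, Complex.normSq_eq_norm_sq]
  field_simp
  ring

/-- A set unbounded below has infimum `0` by convention, so positivity of the infimum already
contains boundedness. -/
lemma sInf_image_le_of_pos {ι : Type*} {s : Set ι} {f : ι → ℝ} (h : 0 < sInf (f '' s)) {x : ι}
    (hx : x ∈ s) : sInf (f '' s) ≤ f x := by
  have hb : BddBelow (f '' s) := by
    by_contra hb
    rw [Real.sInf_of_not_bddBelow hb] at h
    exact h.false
  exact csInf_le hb ⟨x, hx, rfl⟩

/-- The constant is chosen before `J`, although `CondRe J` depends on `J`. If `CondIm` fails, the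
infimum for the least `J₀ ≥ 3` with `CondRe J₀` works for every admissible `J`, since `1/C_{J₀}² ≤
eigMin J₀ ≤ eigMin J`. If no such `J₀` exists either, the claim is vacuous. -/
lemma exists_coercive (D : Data) : ∃ c, 0 < c ∧ ∀ J, 3 ≤ J → (D.CondRe J ∨ D.CondIm) →
    ∀ r ∈ Icc 0 D.R, Coercive c J (D.ζ r) := by
  by_cases hIm : D.CondIm
  · obtain ⟨d, hd, hpos⟩ := hIm
    -- The sign is reversed because `Im ζ` is minus the expression in `CondIm`.
    refine ⟨_, hpos, fun J _ _ r hr => Or.inr ⟨-d, ?_, fun y hy => ?_⟩⟩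
    · rcases hd with rfl | rfl <;> simp
    · have h := sInf_image_le_of_pos hpos (x := (r, y)) ⟨hr, hy⟩
      refine h.trans (le_of_eq ?_)
      rw [zeta_im]
      ring
  by_cases hRe : ∃ J, 3 ≤ J ∧ D.CondRe J
  · classical
    obtain ⟨h3, hpos⟩ := Nat.find_spec hRe
    refine ⟨_, hpos, fun J hJ hcond r hr => Or.inl fun y hy => ?_⟩
    have hle : Nat.find hRe ≤ J := Nat.find_min' hRe ⟨hJ, hcond.resolve_right hIm⟩
    have h := sInf_image_le_of_pos hpos (x := (r, y)) ⟨hr, hy⟩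
    refine h.trans ?_
    rw [zeta_re]
    exact sub_le_sub_right ((inv_discretePF_sq_le (by omega)).trans
      (eigMin_mono (by omega) hle)) _
  · refine ⟨1, one_pos, fun J hJ hcond => ?_⟩
    exact absurd ⟨J, hJ, hcond.resolve_right hIm⟩ hRe

end Data

end CNFD

namespace CNFD

namespace Data

variable {D : Data}

/-! ### The auxiliary function `w = u_r - i (λ/q) u - δ y u_y` -/

/-- The function to which the elliptic operator is applied in the evolution problem. -/
noncomputable def aux (D : Data) (u : ℝ → ℝ → ℂ) (r : ℝ) : ℝ → ℂ := fun x =>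
  D.dr u r x - Complex.I * (D.lam / D.q) * u r x - (D.δ r : ℂ) * (x : ℂ) * dy u r x

variable {u₀ : ℝ → ℂ} {u : ℝ → ℝ → ℂ} {r r' : ℝ}

lemma dr_eq_zero {f : ℝ → ℝ → ℂ} {y : ℝ} (hf : ∀ r ∈ Icc 0 D.R, f r y = 0)
    (hr : r ∈ Icc 0 D.R) : D.dr f r y = 0 := by
  unfold dr
  rw [derivWithin_congr (f := fun _ => (0 : ℂ)) hf (hf r hr)]
  simp

lemma IsSolution.aux_zero (h : D.IsSolution u₀ u) (hr : r ∈ Icc 0 D.R) : D.aux u r 0 = 0 := by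
  simp [aux, dr_eq_zero h.top hr, h.top r hr]

/-- The condition `u_y(r,1) = 0` is needed here: at the upper end the factor `y` no longer removes
the drift term. -/
lemma IsSolution.aux_one (h : D.IsSolution u₀ u) (hr : r ∈ Icc 0 D.R) : D.aux u r 1 = 0 := by
  simp [aux, dr_eq_zero h.bottom hr, h.bottom r hr, h.bottom_deriv r hr]

lemma contDiffOn_aux (hu : ContDiffOn ℝ (4 : ℕ) (Function.uncurry u) D.Ω) (hr : r ∈ Icc 0 D.R) :
    ContDiffOn ℝ (2 : ℕ) (D.aux u r) (Icc 0 1) := by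
  have h1 := slice (contDiffOn_dr (m := 2) (hu.of_le (by norm_cast))) hr
  have h2 := slice (contDiffOn_dy (m := 2) (hu.of_le (by norm_cast))) hr
  have h3 := slice (hu.of_le (show ((2 : ℕ) : WithTop ℕ∞) ≤ (4 : ℕ) by norm_cast)) hr
  have h4 : ContDiffOn ℝ (2 : ℕ) (fun x : ℝ => (x : ℂ)) (Icc 0 1) :=
    Complex.ofRealCLM.contDiff.contDiffOn
  exact (h1.sub (contDiffOn_const.mul h3)).sub ((contDiffOn_const.mul h4).mul h2)

/-- The inhomogeneity of the elliptic equation for `aux`. -/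
noncomputable def rhs (D : Data) (u : ℝ → ℝ → ℂ) (r : ℝ) : ℝ → ℂ := fun y =>
  Complex.I * D.ξ r * u r y

lemma IsSolution.aux_chain (h : D.IsSolution u₀ u)
    (hu : ContDiffOn ℝ (4 : ℕ) (Function.uncurry u) D.Ω) (hr : r ∈ Icc 0 D.R) :
    ∃ w1, DerivOn 0 1 (D.aux u r) w1 ∧
      DerivOn 0 1 w1 fun y => -(D.ζ r y * D.aux u r y + D.rhs u r y) := by
  have hc := contDiffOn_aux hu hr
  refine ⟨_, DerivOn.of_contDiffOn (hc.of_le (by norm_cast)), fun y hy => ?_⟩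
  have h1 := hc.derivWithin (uniqueDiffOn_Icc zero_lt_one) (m := 1) (by norm_cast)
  have h2 := DerivOn.of_contDiffOn h1 y hy
  convert h2 using 1
  have h3 := h.pde r hr y hy
  change -iteratedDerivWithin 2 (D.aux u r) (Icc 0 1) y - D.ζ r y * D.aux u r y = D.rhs u r y at h3
  rw [iteratedDerivWithin_succ, iteratedDerivWithin_one] at h3
  rw [eq_comm]
  linear_combination -h3

section Bounds

variable {M M' Z c : ℝ} {J : ℕ}

lemma IsSolution.c2Bound (h : D.IsSolution u₀ u)
    (hu : ContDiffOn ℝ (4 : ℕ) (Function.uncurry u) D.Ω)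
    (hM : ∀ r ∈ Icc 0 D.R, ∀ y ∈ Icc (0 : ℝ) 1, ‖dy^[3] u r y‖ ≤ M) (hr : r ∈ Icc 0 D.R) :
    C2Bound (u r) (3 * M) :=
  C2Bound.of_third (derivOn_dy_iterate (n := 0) (by norm_num) hu hr)
    (derivOn_dy_iterate (n := 1) (by norm_num) hu hr)
    (derivOn_dy_iterate (n := 2) (by norm_num) hu hr) (hM r hr) (h.top r hr) (h.bottom r hr)
    (h.bottom_deriv r hr)

lemma norm_dy3_sub_le (hu : ContDiffOn ℝ (4 : ℕ) (Function.uncurry u) D.Ω)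
    (hM' : ∀ r ∈ Icc 0 D.R, ∀ y ∈ Icc (0 : ℝ) 1, ‖D.dr (dy^[3] u) r y‖ ≤ M')
    (hr : r ∈ Icc 0 D.R) (hr' : r' ∈ Icc 0 D.R) {y : ℝ} (hy : y ∈ Icc (0 : ℝ) 1) :
    ‖dy^[3] u r y - dy^[3] u r' y‖ ≤ M' * |r - r'| := by
  have h1 : ContDiffOn ℝ (1 : ℕ) (Function.uncurry (dy^[3] u)) D.Ω := contDiffOn_dy_iterate hu
  exact (derivOn_fst (by exact_mod_cast h1) hy).norm_sub_le (fun t ht => hM' t ht y hy) hr' hr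

lemma IsSolution.c2Bound_sub (h : D.IsSolution u₀ u)
    (hu : ContDiffOn ℝ (4 : ℕ) (Function.uncurry u) D.Ω)
    (hM' : ∀ r ∈ Icc 0 D.R, ∀ y ∈ Icc (0 : ℝ) 1, ‖D.dr (dy^[3] u) r y‖ ≤ M')
    (hr : r ∈ Icc 0 D.R) (hr' : r' ∈ Icc 0 D.R) :
    C2Bound (fun y => u r y - u r' y) (3 * (M' * |r - r'|)) := by
  have d0 := fun {r} hr => derivOn_dy_iterate (r := r) (n := 0) (by norm_num) hu hr
  have d1 := fun {r} hr => derivOn_dy_iterate (r := r) (n := 1) (by norm_num) hu hr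
  have d2 := fun {r} hr => derivOn_dy_iterate (r := r) (n := 2) (by norm_num) hu hr
  refine C2Bound.of_third ((d0 hr).sub (d0 hr')) ((d1 hr).sub (d1 hr')) ((d2 hr).sub (d2 hr'))
    (fun y hy => norm_dy3_sub_le hu hM' hr hr' hy) ?_ ?_ ?_
  · simp [h.top r hr, h.top r' hr']
  · simp [h.bottom r hr, h.bottom r' hr']
  · simp [h.bottom_deriv r hr, h.bottom_deriv r' hr']

lemma IsSolution.c2Bound_rhs (h : D.IsSolution u₀ u)
    (hu : ContDiffOn ℝ (4 : ℕ) (Function.uncurry u) D.Ω) (hZ : D.CoefBound Z)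
    (hM : ∀ r ∈ Icc 0 D.R, ∀ y ∈ Icc (0 : ℝ) 1, ‖dy^[3] u r y‖ ≤ M) (hr : r ∈ Icc 0 D.R) :
    C2Bound (D.rhs u r) (Z * (3 * M)) := by
  have h1 := h.c2Bound hu hM hr
  refine (h1.const_mul (Complex.I * D.ξ r)).mono ?_
  rw [norm_mul, Complex.norm_I, one_mul]
  exact mul_le_mul_of_nonneg_right (hZ.xi r hr) h1.nonneg

lemma IsSolution.c2Bound_aux (h : D.IsSolution u₀ u)
    (hu : ContDiffOn ℝ (4 : ℕ) (Function.uncurry u) D.Ω) (hZ : D.CoefBound Z) (hc : 0 < c)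
    (hJ : 2 ≤ J) (hcoer : Coercive c J (D.ζ r))
    (hM : ∀ r ∈ Icc 0 D.R, ∀ y ∈ Icc (0 : ℝ) 1, ‖dy^[3] u r y‖ ≤ M) (hr : r ∈ Icc 0 D.R) :
    C2Bound (D.aux u r) (ellConst c Z * (Z * (3 * M))) ∧
      C2Bound (fun y => -(D.ζ r y * D.aux u r y + D.rhs u r y))
        (ellConst' c Z * (Z * (3 * M))) := by
  obtain ⟨w1, h1, h2⟩ := h.aux_chain hu hr
  exact elliptic_regularity hJ hc hcoer (hZ.zeta r hr) (h.c2Bound_rhs hu hZ hM hr) h1 h2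
    (h.aux_zero hr) (h.aux_one hr)

/-- The inhomogeneity of the elliptic equation for the difference `aux u r - aux u r'`. -/
noncomputable def rhsDiff (D : Data) (u : ℝ → ℝ → ℂ) (r r' : ℝ) : ℝ → ℂ := fun y =>
  (D.ζ r y - D.ζ r' y) * D.aux u r' y
    + (Complex.I * D.ξ r * (u r y - u r' y) + Complex.I * (D.ξ r - D.ξ r') * u r' y)

/-- Constant in the bound of `rhsDiff`. -/
noncomputable def diffConst (c Z : ℝ) : ℝ := 12 * (Z * (ellConst c Z * Z)) + 3 * Z

lemma IsSolution.c2Bound_rhsDiff (h : D.IsSolution u₀ u)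
    (hu : ContDiffOn ℝ (4 : ℕ) (Function.uncurry u) D.Ω) (hZ : D.CoefBound Z) (hc : 0 < c)
    (hJ : 2 ≤ J) (hcoer' : Coercive c J (D.ζ r'))
    (hM : ∀ r ∈ Icc 0 D.R, ∀ y ∈ Icc (0 : ℝ) 1, ‖dy^[3] u r y‖ ≤ M)
    (hM' : ∀ r ∈ Icc 0 D.R, ∀ y ∈ Icc (0 : ℝ) 1, ‖D.dr (dy^[3] u) r y‖ ≤ M')
    (hr : r ∈ Icc 0 D.R) (hr' : r' ∈ Icc 0 D.R) :
    C2Bound (D.rhsDiff u r r') (diffConst c Z * (|r - r'| * (M + M'))) := by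
  have hZ0 := (hZ.zeta r hr).nonneg
  have hE := ellConst_pos hc hZ0
  have hM0 : 0 ≤ M := (norm_nonneg _).trans (hM r hr 0 (by simp))
  have hM0' : 0 ≤ M' := (norm_nonneg _).trans (hM' r hr 0 (by simp))
  have h1 := (hZ.zeta_sub r hr r' hr').mul (h.c2Bound_aux hu hZ hc hJ hcoer' hM hr').1
  have h2 := (h.c2Bound_sub hu hM' hr hr').const_mul (Complex.I * D.ξ r)
  have h3 := (h.c2Bound hu hM hr').const_mul (Complex.I * (D.ξ r - D.ξ r'))
  refine (h1.add (h2.add h3)).mono ?_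
  rw [norm_mul, norm_mul, Complex.norm_I, one_mul, one_mul]
  calc _ ≤ 4 * (Z * |r - r'| * (ellConst c Z * (Z * (3 * M))))
        + (Z * (3 * (M' * |r - r'|)) + Z * |r - r'| * (3 * M)) := by
        gcongr
        · exact hZ.xi r hr
        · exact hZ.xi_sub r hr r' hr'
    -- `diffConst` weights `M` and `M'` equally; the subtracted term is the resulting surplus, since
    -- the coefficient difference produces only `M`.
    _ = diffConst c Z * (|r - r'| * (M + M'))
        - 12 * (Z * (ellConst c Z * Z)) * (|r - r'| * M') := by unfold diffConst; ring
    _ ≤ _ := by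
        have : 0 ≤ 12 * (Z * (ellConst c Z * Z)) * (|r - r'| * M') := by positivity
        linarith

/-- The consistency error of the discrete elliptic problem at `r`. -/
noncomputable def ellipErr (D : Data) (J : ℕ) (u : ℝ → ℝ → ℂ) (r : ℝ) : Xh J :=
  D.ellipH J r (interp J (D.aux u r)) - (Complex.I * D.ξ r) • interp J (u r)

lemma IsSolution.ellipErr_apply (h : D.IsSolution u₀ u) (hr : r ∈ Icc 0 D.R) {j : ℕ}
    (hj : 0 < j) (hjJ : j < J) :
    (D.ellipErr J u r).1 j
      = discOp J (D.ζ r) (fun i => D.aux u r (node J i)) j - D.rhs u r (node J j) := by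
  have hap : ∀ i ≤ J, (interp J (D.aux u r)).1 i = D.aux u r (node J i) := fun i hi =>
    interp_apply (by omega) (h.aux_zero hr) (h.aux_one hr) hi
  change (D.ellipH J r (interp J (D.aux u r))).1 j
    - (Complex.I * D.ξ r) * (interp J (u r)).1 j = _
  have hU : (interp J (u r)).1 j = u r (node J j) := ofInterior_apply _ hj hjJ
  rw [ellipH_apply _ _ _ hj hjJ, hU, rhs, discOp, discOp]
  change _ = -((D.aux u r (node J (j - 1)) - _ + _) / _) - _ - _
  rw [← hap (j - 1) (by omega), ← hap j (by omega), ← hap (j + 1) (by omega)]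

lemma IsSolution.normInf_ellipErr_le (h : D.IsSolution u₀ u)
    (hu : ContDiffOn ℝ (4 : ℕ) (Function.uncurry u) D.Ω) (hZ : D.CoefBound Z) (hc : 0 < c)
    (hJ : 2 ≤ J) (hcoer : Coercive c J (D.ζ r))
    (hM : ∀ r ∈ Icc 0 D.R, ∀ y ∈ Icc (0 : ℝ) 1, ‖dy^[3] u r y‖ ≤ M) (hr : r ∈ Icc 0 D.R) :
    normInf (D.ellipErr J u r) ≤ 6 * ellConst' c Z * Z * (mesh J ^ 2 * M) := by
  obtain ⟨w1, h1, h2⟩ := h.aux_chain hu hr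
  have h3 := (h.c2Bound_aux hu hZ hc hJ hcoer hM hr).2
  have h30 := h3.nonneg
  have e : 6 * ellConst' c Z * Z * (mesh J ^ 2 * M)
      = 2 * (ellConst' c Z * (Z * (3 * M))) * mesh J ^ 2 := by ring
  rw [e]
  refine normInf_le (by positivity) fun j hj hjJ => ?_
  have h4 := norm_discOp_sub_le (a := D.ζ r) h1 h2 h3 hj hjJ
  rw [h.ellipErr_apply hr hj hjJ]
  convert h4 using 3
  ring

/-- The zero-order terms are exact at the nodes, so the difference of the two errors is a single
consistency error, that of `aux u r - aux u r'`. Elliptic regularity for `rhsDiff` supplies both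
factors `|r - r'|` and `h²` without higher derivatives of `u`. -/
lemma IsSolution.normInf_ellipErr_sub_le (h : D.IsSolution u₀ u)
    (hu : ContDiffOn ℝ (4 : ℕ) (Function.uncurry u) D.Ω) (hZ : D.CoefBound Z) (hc : 0 < c)
    (hJ : 2 ≤ J) (hcoer : Coercive c J (D.ζ r)) (hcoer' : Coercive c J (D.ζ r'))
    (hM : ∀ r ∈ Icc 0 D.R, ∀ y ∈ Icc (0 : ℝ) 1, ‖dy^[3] u r y‖ ≤ M)
    (hM' : ∀ r ∈ Icc 0 D.R, ∀ y ∈ Icc (0 : ℝ) 1, ‖D.dr (dy^[3] u) r y‖ ≤ M')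
    (hr : r ∈ Icc 0 D.R) (hr' : r' ∈ Icc 0 D.R) :
    normInf (D.ellipErr J u r - D.ellipErr J u r')
      ≤ 2 * ellConst' c Z * diffConst c Z * (|r - r'| * mesh J ^ 2 * (M + M')) := by
  obtain ⟨w1, h1, h2⟩ := h.aux_chain hu hr
  obtain ⟨w1', h1', h2'⟩ := h.aux_chain hu hr'
  have k1 := h1.sub h1'
  have k2 : DerivOn 0 1 (fun y => w1 y - w1' y)
      fun y => -(D.ζ r y * (D.aux u r y - D.aux u r' y) + D.rhsDiff u r r' y) := fun y hy => by
    convert h2.sub h2' y hy using 1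
    simp only [rhsDiff, rhs]
    ring
  have k3 := (elliptic_regularity hJ hc hcoer (hZ.zeta r hr)
    (h.c2Bound_rhsDiff hu hZ hc hJ hcoer' hM hM' hr hr') k1 k2
    (by simp [h.aux_zero hr, h.aux_zero hr']) (by simp [h.aux_one hr, h.aux_one hr'])).2
  have h30 := k3.nonneg
  have e : 2 * ellConst' c Z * diffConst c Z * (|r - r'| * mesh J ^ 2 * (M + M'))
      = 2 * (ellConst' c Z * (diffConst c Z * (|r - r'| * (M + M')))) * mesh J ^ 2 := by ring
  rw [e]
  refine normInf_le (by positivity) fun j hj hjJ => ?_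
  have h4 := norm_discOp_sub_le (a := D.ζ r) k1 k2 k3 hj hjJ
  change ‖(D.ellipErr J u r).1 j - (D.ellipErr J u r').1 j‖ ≤ _
  rw [h.ellipErr_apply hr hj hjJ, h.ellipErr_apply hr' hj hjJ]
  convert h4 using 2
  simp only [discOp, rhsDiff, rhs]
  ring

end Bounds

end Data

end CNFD

namespace CNFD

/-! ### Difference quotients and averages -/

section Quotients

variable {a b c k M : ℝ} {f f1 f2 f3 f4 : ℝ → ℂ}

/-- Error of the central difference quotient of step `k/2`. -/
noncomputable def quotErr (f f1 : ℝ → ℂ) (k c : ℝ) : ℂ :=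
  (f (c + k / 2) - f (c - k / 2)) / k - f1 c

/-- Error of the two-point average. -/
noncomputable def avgErr (f : ℝ → ℂ) (k c : ℝ) : ℂ :=
  (f (c + k / 2) + f (c - k / 2)) / 2 - f c

lemma norm_quotErr_le (hf : DerivOn a b f f1) (hf1 : DerivOn a b f1 f2) (hf2 : DerivOn a b f2 f3)
    (hM : ∀ t ∈ Icc a b, ‖f3 t‖ ≤ M) (hk : 0 < k) (ha : a ≤ c - k / 2) (hb : c + k / 2 ≤ b) :
    ‖quotErr f f1 k c‖ ≤ k ^ 2 * M := by
  have hM0 : 0 ≤ M := (norm_nonneg _).trans (hM a ⟨le_rfl, by linarith⟩)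
  have h := hf.norm_central_sub_le hf1 hf2 hM ha hb (t := k / 2) ⟨by positivity, le_rfl⟩
  have hkc : (k : ℂ) ≠ 0 := by exact_mod_cast hk.ne'
  have e : quotErr f f1 k c
      = (f (c + k / 2) - f (c - k / 2) - 2 * ((k / 2 : ℝ) : ℂ) * f1 c) / k := by
    rw [quotErr]; push_cast; field_simp
  rw [e, norm_div, Complex.norm_real, Real.norm_of_nonneg hk.le, div_le_iff₀ hk]
  refine h.trans ?_
  have : 0 ≤ M * k ^ 3 := by positivity
  linarith

lemma norm_avgErr_le (hf : DerivOn a b f f1) (hf1 : DerivOn a b f1 f2)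
    (hM : ∀ t ∈ Icc a b, ‖f2 t‖ ≤ M) (hk : 0 < k) (ha : a ≤ c - k / 2) (hb : c + k / 2 ≤ b) :
    ‖avgErr f k c‖ ≤ k ^ 2 * M := by
  have hM0 : 0 ≤ M := (norm_nonneg _).trans (hM a ⟨le_rfl, by linarith⟩)
  have h := hf.norm_secondDiff_le hf1 hM ha hb (t := k / 2) ⟨by positivity, le_rfl⟩
  have e : avgErr f k c = (f (c + k / 2) + f (c - k / 2) - 2 * f c) / 2 := by
    rw [avgErr]; ring
  rw [e, norm_div, div_le_iff₀ (by norm_num), Complex.norm_ofNat]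
  refine h.trans ?_
  have : 0 ≤ M * k ^ 2 := by positivity
  linarith

/-- Both error functionals commute with translation, so consecutive errors differ by the error of
`f(t) - f(t - k)`, whose derivatives carry a factor `k` by `DerivOn.norm_shift_le`. -/
lemma DerivOn.shift_sub (hf : DerivOn a b f f1) (hk : 0 ≤ k) :
    DerivOn (a + k) b (fun t => f t - f (t - k)) (fun t => f1 t - f1 (t - k)) := by
  have h := hf.comp_affine (a' := a + k) (b' := b) (-k) 1
    (fun t ht => ⟨by linarith [ht.1], by linarith [ht.2]⟩)
  have h2 := (hf.mono (by linarith : a ≤ a + k) le_rfl).sub h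
  simpa [neg_add_eq_sub] using h2

lemma DerivOn.norm_shift_le (hf : DerivOn a b f f1) (hM : ∀ t ∈ Icc a b, ‖f1 t‖ ≤ M)
    (hk : 0 ≤ k) : ∀ t ∈ Icc (a + k) b, ‖f t - f (t - k)‖ ≤ k * M := fun t ht => by
  have h := hf.norm_sub_le hM (x := t - k) (y := t) ⟨by linarith [ht.1], by linarith [ht.2]⟩
    ⟨by linarith [ht.1], ht.2⟩
  rwa [sub_sub_cancel, abs_of_nonneg hk, mul_comm] at h

lemma norm_quotErr_sub_le (hf : DerivOn a b f f1) (hf1 : DerivOn a b f1 f2)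
    (hf2 : DerivOn a b f2 f3) (hf3 : DerivOn a b f3 f4) (hM : ∀ t ∈ Icc a b, ‖f4 t‖ ≤ M)
    (hk : 0 < k) (ha : a + k ≤ c - k / 2) (hb : c + k / 2 ≤ b) :
    ‖quotErr f f1 k c - quotErr f f1 k (c - k)‖ ≤ k ^ 3 * M := by
  have h := norm_quotErr_le (hf.shift_sub hk.le) (hf1.shift_sub hk.le) (hf2.shift_sub hk.le)
    (hf3.norm_shift_le hM hk.le) hk ha hb
  have e : quotErr f f1 k c - quotErr f f1 k (c - k)
      = quotErr (fun t => f t - f (t - k)) (fun t => f1 t - f1 (t - k)) k c := by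
    simp only [quotErr]
    rw [show c - k + k / 2 = c + k / 2 - k by ring, show c - k - k / 2 = c - k / 2 - k by ring]
    ring
  rw [e]
  exact h.trans (le_of_eq (by ring))

lemma norm_avgErr_sub_le (hf : DerivOn a b f f1) (hf1 : DerivOn a b f1 f2)
    (hf2 : DerivOn a b f2 f3) (hM : ∀ t ∈ Icc a b, ‖f3 t‖ ≤ M)
    (hk : 0 < k) (ha : a + k ≤ c - k / 2) (hb : c + k / 2 ≤ b) :
    ‖avgErr f k c - avgErr f k (c - k)‖ ≤ k ^ 3 * M := by
  have h := norm_avgErr_le (hf.shift_sub hk.le) (hf1.shift_sub hk.le)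
    (hf2.norm_shift_le hM hk.le) hk ha hb
  have e : avgErr f k c - avgErr f k (c - k) = avgErr (fun t => f t - f (t - k)) k c := by
    simp only [avgErr]
    rw [show c - k + k / 2 = c + k / 2 - k by ring, show c - k - k / 2 = c - k / 2 - k by ring]
    ring
  rw [e]
  exact h.trans (le_of_eq (by ring))

/-- Consistency of the central difference quotient at interior nodes. -/
lemma norm_centralDiff_sub_le (hf : DerivOn 0 1 f f1) (hf1 : DerivOn 0 1 f1 f2)
    (hf2 : DerivOn 0 1 f2 f3) (hM : ∀ t ∈ Icc (0 : ℝ) 1, ‖f3 t‖ ≤ M) {J j : ℕ} (hj : 0 < j)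
    (hJ : j < J) :
    ‖(f (node J (j + 1)) - f (node J (j - 1))) / (2 * (mesh J : ℂ)) - f1 (node J j)‖
      ≤ mesh J ^ 2 * M := by
  have hm := mesh_pos (J := J) (by omega)
  obtain ⟨e1, e2⟩ := mesh_le_node hj hJ
  have h := hf.norm_central_sub_le hf1 hf2 hM e1 e2 (t := mesh J) ⟨hm.le, le_rfl⟩
  have hmc : (mesh J : ℂ) ≠ 0 := by exact_mod_cast hm.ne'
  have e : (f (node J (j + 1)) - f (node J (j - 1))) / (2 * (mesh J : ℂ)) - f1 (node J j)
      = (f (node J j + mesh J) - f (node J j - mesh J) - 2 * (mesh J : ℂ) * f1 (node J j))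
        / ((2 * mesh J : ℝ) : ℂ) := by
    rw [node_succ, node_pred hj]; push_cast; field_simp
  rw [e, norm_div, Complex.norm_real, Real.norm_of_nonneg (by positivity),
    div_le_iff₀ (by positivity)]
  exact h.trans (le_of_eq (by ring))

end Quotients

namespace Data

variable {D : Data} {u₀ : ℝ → ℂ} {u : ℝ → ℝ → ℂ} {J : ℕ} {k r : ℝ}

/-- Error of the space-time central difference, at the range `r` and the node `j`. -/
noncomputable def centralErr (J : ℕ) (k : ℝ) (u : ℝ → ℝ → ℂ) (r : ℝ) (j : ℕ) : ℂ :=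
  ((u (r + k / 2) (node J (j + 1)) + u (r - k / 2) (node J (j + 1))) / 2
    - (u (r + k / 2) (node J (j - 1)) + u (r - k / 2) (node J (j - 1))) / 2)
      / (2 * (mesh J : ℂ)) - dy u r (node J j)

/-- Error of the spatial central difference. -/
noncomputable def spaceErr (J : ℕ) (f : ℝ → ℝ → ℂ) (r : ℝ) (j : ℕ) : ℂ :=
  (f r (node J (j + 1)) - f r (node J (j - 1))) / (2 * (mesh J : ℂ)) - dy f r (node J j)

/-- This separates the two discretisations: pure `h²` errors at the ends of the step, and a pure
`k²` averaging error of `u_y`. -/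
lemma centralErr_eq (J : ℕ) (k : ℝ) (u : ℝ → ℝ → ℂ) (r : ℝ) (j : ℕ) :
    centralErr J k u r j = (spaceErr J u (r + k / 2) j + spaceErr J u (r - k / 2) j) / 2
      + avgErr (fun t => dy u t (node J j)) k r := by
  simp only [centralErr, spaceErr, avgErr]
  ring

/-- The part of the truncation error that does not involve the elliptic problem. -/
noncomputable def localErr (D : Data) (J : ℕ) (k : ℝ) (u : ℝ → ℝ → ℂ) (r : ℝ) : Xh J :=
  ofInterior J fun j =>
    quotErr (fun t => u t (node J j)) (fun t => D.dr u t (node J j)) k r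
      - (D.δ r : ℂ) * ((node J j : ℂ) * centralErr J k u r j)
      - Complex.I * (D.lam / D.q) * avgErr (fun t => u t (node J j)) k r

/-- The right-hand side of the discrete elliptic problem for the remaining part of the truncation
error. -/
noncomputable def sourceErr (D : Data) (J : ℕ) (k : ℝ) (u : ℝ → ℝ → ℂ) (r : ℝ) : Xh J :=
  D.ellipErr J u r
    - ofInterior J fun j => Complex.I * D.ξ r * avgErr (fun t => u t (node J j)) k r

/-! ### The range grid -/

lemma step_pos (D : Data) {N : ℕ} (hN : 1 ≤ N) : 0 < D.step N := by
  have := D.R_pos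
  have : (0 : ℝ) < N := by exact_mod_cast hN
  unfold step; positivity

lemma rnode_mem {N n : ℕ} (hN : 1 ≤ N) (hn : n ≤ N) : D.rnode N n ∈ Icc 0 D.R := by
  have hR := D.R_pos
  have hN' : (0 : ℝ) < N := by exact_mod_cast hN
  have hn' : (n : ℝ) ≤ N := by exact_mod_cast hn
  refine ⟨by unfold rnode step; positivity, ?_⟩
  rw [rnode, step, mul_div_assoc', div_le_iff₀ hN', mul_comm]
  gcongr

lemma rnode_pred {N n : ℕ} (hn : 1 ≤ n) : D.rnode N (n - 1) = D.rnode N n - D.step N := by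
  obtain ⟨m, rfl⟩ : ∃ m, n = m + 1 := ⟨n - 1, by omega⟩
  simp only [rnode, Nat.add_sub_cancel]
  push_cast
  ring

lemma rmid_add {N n : ℕ} (hn : 1 ≤ n) : D.rmid N n + D.step N / 2 = D.rnode N n := by
  rw [rmid, rnode_pred hn]; ring

lemma rmid_sub {N n : ℕ} (hn : 1 ≤ n) : D.rmid N n - D.step N / 2 = D.rnode N (n - 1) := by
  rw [rmid, rnode_pred hn]; ring

lemma rmid_pred {N n : ℕ} (hn : 2 ≤ n) : D.rmid N (n - 1) = D.rmid N n - D.step N := by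
  rw [rmid, rmid, rnode_pred (by omega : 1 ≤ n - 1), rnode_pred (by omega : 1 ≤ n)]; ring

/-! ### Representation of the truncation error -/

/-- The formula includes `j = 0` and `j = J`, thanks to the zero boundary values; the central
difference at the extreme interior nodes reaches these indices. -/
lemma IsSolution.avgAt_apply (h : D.IsSolution u₀ u) {N n : ℕ} (hJ : 1 ≤ J) (hN : 1 ≤ N)
    (hn : 1 ≤ n) (hnN : n ≤ N) {j : ℕ} (hj : j ≤ J) :
    (D.avgAt J N u n).1 j = (u (D.rmid N n + D.step N / 2) (node J j)
      + u (D.rmid N n - D.step N / 2) (node J j)) / 2 := by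
  have h1 := rnode_mem (D := D) hN hnN
  have h2 := rnode_mem (D := D) hN (show n - 1 ≤ N by omega)
  change (1 / 2 : ℂ) * ((interp J (u (D.rnode N n))).1 j
    + (interp J (u (D.rnode N (n - 1)))).1 j) = _
  rw [interp_apply hJ (h.top _ h1) (h.bottom _ h1) hj,
    interp_apply hJ (h.top _ h2) (h.bottom _ h2) hj, rmid_add hn, rmid_sub hn]
  ring

lemma IsSolution.truncationError_eq (h : D.IsSolution u₀ u) {N n : ℕ} (hJ : 1 ≤ J) (hN : 1 ≤ N)
    (hn : 1 ≤ n) (hnN : n ≤ N) (hunit : IsUnit (D.ellipH J (D.rmid N n))) {e : Xh J}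
    (he : D.IsTruncationError J N u n e) :
    e = D.localErr J (D.step N) u (D.rmid N n)
      + D.solH J (D.rmid N n) (D.sourceErr J (D.step N) u (D.rmid N n)) := by
  set r := D.rmid N n with hr
  set k := D.step N with hk
  have hav := fun {j} (hj : j ≤ J) => h.avgAt_apply hJ hN hn hnN hj
  rw [← hr, ← hk] at hav
  -- In this form `T_h` of the source is `P_h w - iξ T_h ū`, which brings in exactly the nonlocal
  -- term of the scheme.
  have hsrc : D.sourceErr J k u r = D.ellipH J r (interp J (D.aux u r))
      - (Complex.I * D.ξ r) • D.avgAt J N u n := by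
    refine Xh.ext_interior fun j hj hjJ => ?_
    have h1 : (interp J (u r)).1 j = u r (node J j) := ofInterior_apply _ hj hjJ
    have h2 := ofInterior_apply (J := J)
      (fun j => Complex.I * D.ξ r * avgErr (fun t => u t (node J j)) k r) hj hjJ
    change (D.ellipH J r (interp J (D.aux u r))).1 j - (Complex.I * D.ξ r) * (interp J (u r)).1 j
      - (ofInterior J _).1 j
      = (D.ellipH J r (interp J (D.aux u r))).1 j - (Complex.I * D.ξ r) * (D.avgAt J N u n).1 j
    rw [h1, h2, hav hjJ.le, avgErr]
    ring
  rw [hsrc, map_sub, map_smul, solH_ellipH hunit]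
  have he' : e = (1 / (k : ℂ)) • (D.exactAt J N u n - D.exactAt J N u (n - 1))
      - (D.δ r : ℂ) • tensor (omega J) (centralDiff (D.avgAt J N u n))
      - (Complex.I * D.ξ r) • D.solH J r (D.avgAt J N u n)
      - (Complex.I * (D.lam / D.q)) • D.avgAt J N u n := by
    have := he
    unfold IsTruncationError at this
    rw [this]; abel
  rw [he']
  have key : (1 / (k : ℂ)) • (D.exactAt J N u n - D.exactAt J N u (n - 1))
      - (D.δ r : ℂ) • tensor (omega J) (centralDiff (D.avgAt J N u n))
      - (Complex.I * (D.lam / D.q)) • D.avgAt J N u n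
      = D.localErr J k u r + interp J (D.aux u r) := by
    refine Xh.ext_interior fun j hj hjJ => ?_
    have e1 : (D.exactAt J N u n).1 j = u (r + k / 2) (node J j) := by
      rw [hr, hk, rmid_add hn]; exact ofInterior_apply _ hj hjJ
    have e2 : (D.exactAt J N u (n - 1)).1 j = u (r - k / 2) (node J j) := by
      rw [hr, hk, rmid_sub hn]; exact ofInterior_apply _ hj hjJ
    have e3 : (tensor (omega J) (centralDiff (D.avgAt J N u n))).1 j
        = (node J j : ℂ) * (((D.avgAt J N u n).1 (j + 1) - (D.avgAt J N u n).1 (j - 1))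
          / (2 * (mesh J : ℂ))) := by
      simp [tensor, omega, centralDiff, ofInterior, hj, hjJ]
    have e4 : (D.localErr J k u r).1 j = _ := ofInterior_apply _ hj hjJ
    have e5 : (interp J (D.aux u r)).1 j = D.aux u r (node J j) := ofInterior_apply _ hj hjJ
    change (1 / (k : ℂ)) * ((D.exactAt J N u n).1 j - (D.exactAt J N u (n - 1)).1 j)
      - (D.δ r : ℂ) * (tensor (omega J) (centralDiff (D.avgAt J N u n))).1 j
      - (Complex.I * (D.lam / D.q)) * (D.avgAt J N u n).1 j
      = (D.localErr J k u r).1 j + (interp J (D.aux u r)).1 j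
    rw [e1, e2, e3, e4, e5, hav hjJ.le, hav (show j + 1 ≤ J by omega),
      hav (show j - 1 ≤ J by omega)]
    simp only [quotErr, centralErr, avgErr, aux]
    ring
  have key2 := congrArg (fun x => x - (Complex.I * D.ξ r) • D.solH J r (D.avgAt J N u n)) key
  calc _ = _ := by abel
    _ = _ := key2
    _ = _ := by abel

end Data

end CNFD

namespace CNFD

namespace Data

variable {D : Data} {u₀ : ℝ → ℂ} {u : ℝ → ℝ → ℂ} {J : ℕ} {k r y Z M M' c : ℝ}

/-! ### Bounds of the local errors -/

lemma norm_dr_iterate_le {m n : ℕ} {f : ℝ → ℝ → ℂ} (hn : n ≤ m)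
    (hf : ContDiffOn ℝ m (Function.uncurry f) D.Ω) (hy : y ∈ Icc (0 : ℝ) 1) :
    ∀ t ∈ Icc 0 D.R, ‖D.dr^[n] f t y‖ ≤ D.supΩ (D.dr^[n] f) := fun _ ht =>
  norm_le_supΩ (contDiffOn_dr_iterate (m := 0) (hf.of_le (by norm_cast; omega))).continuousOn ht hy

lemma norm_avgErr_dr_le {m : ℕ} {f : ℝ → ℝ → ℂ} (hm : 2 ≤ m)
    (hf : ContDiffOn ℝ m (Function.uncurry f) D.Ω) (hk : 0 < k) (ha : 0 ≤ r - k / 2)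
    (hb : r + k / 2 ≤ D.R) (hy : y ∈ Icc (0 : ℝ) 1) :
    ‖avgErr (fun t => f t y) k r‖ ≤ k ^ 2 * D.supΩ (D.dr^[2] f) :=
  norm_avgErr_le (derivOn_dr_iterate (n := 0) (by omega) hf hy)
    (derivOn_dr_iterate (n := 1) (by omega) hf hy) (norm_dr_iterate_le hm hf hy) hk ha hb

lemma norm_avgErr_dr_sub_le {m : ℕ} {f : ℝ → ℝ → ℂ} (hm : 3 ≤ m)
    (hf : ContDiffOn ℝ m (Function.uncurry f) D.Ω) (hk : 0 < k) (ha : 0 + k ≤ r - k / 2)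
    (hb : r + k / 2 ≤ D.R) (hy : y ∈ Icc (0 : ℝ) 1) :
    ‖avgErr (fun t => f t y) k r - avgErr (fun t => f t y) k (r - k)‖
      ≤ k ^ 3 * D.supΩ (D.dr^[3] f) :=
  norm_avgErr_sub_le (derivOn_dr_iterate (n := 0) (by omega) hf hy)
    (derivOn_dr_iterate (n := 1) (by omega) hf hy)
    (derivOn_dr_iterate (n := 2) (by omega) hf hy) (norm_dr_iterate_le hm hf hy) hk ha hb

lemma norm_quotErr_dr_le (hu : ContDiffOn ℝ (4 : ℕ) (Function.uncurry u) D.Ω) (hk : 0 < k)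
    (ha : 0 ≤ r - k / 2) (hb : r + k / 2 ≤ D.R) (hy : y ∈ Icc (0 : ℝ) 1) :
    ‖quotErr (fun t => u t y) (fun t => D.dr u t y) k r‖ ≤ k ^ 2 * D.supΩ (D.dr^[3] u) :=
  norm_quotErr_le (derivOn_dr_iterate (n := 0) (by norm_num) hu hy)
    (derivOn_dr_iterate (n := 1) (by norm_num) hu hy)
    (derivOn_dr_iterate (n := 2) (by norm_num) hu hy)
    (norm_dr_iterate_le (by norm_num) hu hy) hk ha hb

lemma norm_quotErr_dr_sub_le (hu : ContDiffOn ℝ (4 : ℕ) (Function.uncurry u) D.Ω) (hk : 0 < k)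
    (ha : 0 + k ≤ r - k / 2) (hb : r + k / 2 ≤ D.R) (hy : y ∈ Icc (0 : ℝ) 1) :
    ‖quotErr (fun t => u t y) (fun t => D.dr u t y) k r
      - quotErr (fun t => u t y) (fun t => D.dr u t y) k (r - k)‖
      ≤ k ^ 3 * D.supΩ (D.dr^[4] u) :=
  norm_quotErr_sub_le (derivOn_dr_iterate (n := 0) (by norm_num) hu hy)
    (derivOn_dr_iterate (n := 1) (by norm_num) hu hy)
    (derivOn_dr_iterate (n := 2) (by norm_num) hu hy)
    (derivOn_dr_iterate (n := 3) (by norm_num) hu hy)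
    (norm_dr_iterate_le (by norm_num) hu hy) hk ha hb

/-- Since `u` vanishes at `y = 0`, the averaging error is controlled by that of `u_y`. -/
lemma IsSolution.norm_avgErr_le_dy (h : D.IsSolution u₀ u)
    (hu : ContDiffOn ℝ (4 : ℕ) (Function.uncurry u) D.Ω) (hk : 0 < k) (ha : 0 ≤ r - k / 2)
    (hb : r + k / 2 ≤ D.R) (hy : y ∈ Icc (0 : ℝ) 1) :
    ‖avgErr (fun t => u t y) k r‖ ≤ k ^ 2 * D.supΩ (D.dr^[2] (dy u)) := by
  have h1 : r + k / 2 ∈ Icc 0 D.R := ⟨by linarith, hb⟩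
  have h2 : r - k / 2 ∈ Icc 0 D.R := ⟨ha, by linarith⟩
  have h3 : r ∈ Icc 0 D.R := ⟨by linarith, by linarith⟩
  have d := fun {r} (hr : r ∈ Icc 0 D.R) =>
    derivOn_dy_iterate (r := r) (n := 0) (by norm_num) hu hr
  have hd : DerivOn 0 1 (fun y => avgErr (fun t => u t y) k r)
      (fun y => avgErr (fun t => dy u t y) k r) := by
    have := (((d h1).add (d h2)).const_mul (1 / 2)).sub (d h3)
    intro t ht
    convert this t ht using 1
    · funext y
      simp only [avgErr, Function.iterate_zero, id]
      ring
    · simp only [avgErr, Function.iterate_one, zero_add]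
      ring
  refine hd.norm_le_of_zero (fun y hy => norm_avgErr_dr_le (m := 3) (by norm_num)
    (contDiffOn_dy (m := 3) hu) hk ha hb hy) (x := 0) (by simp) ?_ hy
  simp [avgErr, h.top _ h1, h.top _ h2, h.top _ h3]

lemma norm_spaceErr_le (hu : ContDiffOn ℝ (4 : ℕ) (Function.uncurry u) D.Ω)
    (hM : ∀ r ∈ Icc 0 D.R, ∀ y ∈ Icc (0 : ℝ) 1, ‖dy^[3] u r y‖ ≤ M)
    (hr : r ∈ Icc 0 D.R) {j : ℕ} (hj : 0 < j) (hjJ : j < J) :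
    ‖spaceErr J u r j‖ ≤ mesh J ^ 2 * M :=
  norm_centralDiff_sub_le (derivOn_dy_iterate (n := 0) (by norm_num) hu hr)
    (derivOn_dy_iterate (n := 1) (by norm_num) hu hr)
    (derivOn_dy_iterate (n := 2) (by norm_num) hu hr) (hM r hr) hj hjJ

lemma norm_spaceErr_sub_le (hu : ContDiffOn ℝ (4 : ℕ) (Function.uncurry u) D.Ω)
    (hM' : ∀ r ∈ Icc 0 D.R, ∀ y ∈ Icc (0 : ℝ) 1, ‖D.dr (dy^[3] u) r y‖ ≤ M')
    {r' : ℝ} (hr : r ∈ Icc 0 D.R) (hr' : r' ∈ Icc 0 D.R) {j : ℕ} (hj : 0 < j) (hjJ : j < J) :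
    ‖spaceErr J u r j - spaceErr J u r' j‖ ≤ mesh J ^ 2 * (M' * |r - r'|) := by
  have d0 := fun {r} hr => derivOn_dy_iterate (r := r) (n := 0) (by norm_num) hu hr
  have d1 := fun {r} hr => derivOn_dy_iterate (r := r) (n := 1) (by norm_num) hu hr
  have d2 := fun {r} hr => derivOn_dy_iterate (r := r) (n := 2) (by norm_num) hu hr
  have h := norm_centralDiff_sub_le ((d0 hr).sub (d0 hr')) ((d1 hr).sub (d1 hr'))
    ((d2 hr).sub (d2 hr')) (fun y hy => norm_dy3_sub_le hu hM' hr hr' hy) hj hjJ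
  convert h using 2
  simp only [spaceErr, Function.iterate_zero, Function.iterate_one, id, zero_add]
  ring

lemma norm_centralErr_le (hu : ContDiffOn ℝ (4 : ℕ) (Function.uncurry u) D.Ω)
    (hM : ∀ r ∈ Icc 0 D.R, ∀ y ∈ Icc (0 : ℝ) 1, ‖dy^[3] u r y‖ ≤ M) (hk : 0 < k)
    (ha : 0 ≤ r - k / 2) (hb : r + k / 2 ≤ D.R) {j : ℕ} (hj : 0 < j) (hjJ : j < J) :
    ‖centralErr J k u r j‖ ≤ mesh J ^ 2 * M + k ^ 2 * D.supΩ (D.dr^[2] (dy u)) := by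
  rw [centralErr_eq]
  have h1 := norm_spaceErr_le hu hM (r := r + k / 2) ⟨by linarith, hb⟩ hj hjJ
  have h2 := norm_spaceErr_le hu hM (r := r - k / 2) ⟨ha, by linarith⟩ hj hjJ
  have h3 := norm_avgErr_dr_le (m := 3) (by norm_num) (contDiffOn_dy (m := 3) hu) hk ha hb
    (node_mem hjJ.le)
  refine norm_add_le_of_le ?_ h3
  rw [norm_div, Complex.norm_ofNat, div_le_iff₀ (by norm_num)]
  exact (norm_add_le_of_le h1 h2).trans (le_of_eq (by ring))

lemma norm_centralErr_sub_le (hu : ContDiffOn ℝ (4 : ℕ) (Function.uncurry u) D.Ω)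
    (hM' : ∀ r ∈ Icc 0 D.R, ∀ y ∈ Icc (0 : ℝ) 1, ‖D.dr (dy^[3] u) r y‖ ≤ M') (hk : 0 < k)
    (ha : 0 + k ≤ r - k / 2) (hb : r + k / 2 ≤ D.R) {j : ℕ} (hj : 0 < j) (hjJ : j < J) :
    ‖centralErr J k u r j - centralErr J k u (r - k) j‖
      ≤ k * mesh J ^ 2 * M' + k ^ 3 * D.supΩ (D.dr^[3] (dy u)) := by
  have e : centralErr J k u r j - centralErr J k u (r - k) j
      = ((spaceErr J u (r + k / 2) j - spaceErr J u (r - k + k / 2) j)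
        + (spaceErr J u (r - k / 2) j - spaceErr J u (r - k - k / 2) j)) / 2
        + (avgErr (fun t => dy u t (node J j)) k r
          - avgErr (fun t => dy u t (node J j)) k (r - k)) := by
    rw [centralErr_eq, centralErr_eq]; ring
  rw [e]
  have h1 := norm_spaceErr_sub_le hu hM' (r := r + k / 2) (r' := r - k + k / 2)
    ⟨by linarith, hb⟩ ⟨by linarith, by linarith⟩ hj hjJ
  have h2 := norm_spaceErr_sub_le hu hM' (r := r - k / 2) (r' := r - k - k / 2)
    ⟨by linarith, by linarith⟩ ⟨by linarith, by linarith⟩ hj hjJ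
  have h3 := norm_avgErr_dr_sub_le (m := 3) (by norm_num) (contDiffOn_dy (m := 3) hu) hk ha hb
    (node_mem hjJ.le)
  rw [show r + k / 2 - (r - k + k / 2) = k by ring, abs_of_pos hk] at h1
  rw [show r - k / 2 - (r - k - k / 2) = k by ring, abs_of_pos hk] at h2
  refine norm_add_le_of_le ?_ h3
  rw [norm_div, Complex.norm_ofNat, div_le_iff₀ (by norm_num)]
  exact (norm_add_le_of_le h1 h2).trans (le_of_eq (by ring))

lemma norm_node_le {j : ℕ} (hj : j ≤ J) : ‖(node J j : ℂ)‖ ≤ 1 := by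
  rw [Complex.norm_real, Real.norm_of_nonneg (node_mem hj).1]
  exact (node_mem hj).2

lemma normInf_localErr_le (hu : ContDiffOn ℝ (4 : ℕ) (Function.uncurry u) D.Ω)
    (hZ : D.CoefBound Z) (hM : ∀ r ∈ Icc 0 D.R, ∀ y ∈ Icc (0 : ℝ) 1, ‖dy^[3] u r y‖ ≤ M)
    (hk : 0 < k) (ha : 0 ≤ r - k / 2) (hb : r + k / 2 ≤ D.R) :
    normInf (D.localErr J k u r)
      ≤ k ^ 2 * D.supΩ (D.dr^[3] u)
        + Z * (mesh J ^ 2 * M + k ^ 2 * D.supΩ (D.dr^[2] (dy u)))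
        + Z * (k ^ 2 * D.supΩ (D.dr^[2] u)) := by
  have hr : r ∈ Icc 0 D.R := ⟨by linarith, by linarith⟩
  have hZ0 := (hZ.zeta r hr).nonneg
  have hM0 : 0 ≤ M := (norm_nonneg _).trans (hM r hr 0 (by simp))
  have n1 := D.supΩ_nonneg (D.dr^[3] u)
  have n2 := D.supΩ_nonneg (D.dr^[2] (dy u))
  have n3 := D.supΩ_nonneg (D.dr^[2] u)
  refine normInf_le (by positivity) fun j hj hjJ => ?_
  rw [localErr, ofInterior_apply _ hj hjJ]
  have hy := node_mem hjJ.le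
  refine norm_sub_le_of_le (norm_sub_le_of_le (norm_quotErr_dr_le hu hk ha hb hy) ?_) ?_
  · rw [norm_mul, norm_mul]
    refine mul_le_mul (hZ.delta r hr) ?_ (by positivity) hZ0
    exact (mul_le_of_le_one_left (norm_nonneg _) (norm_node_le hjJ.le)).trans
      (norm_centralErr_le hu hM hk ha hb hj hjJ)
  · rw [norm_mul, norm_mul, Complex.norm_I, one_mul]
    exact mul_le_mul hZ.lam (norm_avgErr_dr_le (by norm_num) hu hk ha hb hy) (norm_nonneg _) hZ0

/-- A product rule in `r`: either the Taylor error or `δ` is differenced. The factor `λ/q` is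
constant, so `u_rr` does not enter. -/
lemma normInf_localErr_sub_le (hu : ContDiffOn ℝ (4 : ℕ) (Function.uncurry u) D.Ω)
    (hZ : D.CoefBound Z) (hM : ∀ r ∈ Icc 0 D.R, ∀ y ∈ Icc (0 : ℝ) 1, ‖dy^[3] u r y‖ ≤ M)
    (hM' : ∀ r ∈ Icc 0 D.R, ∀ y ∈ Icc (0 : ℝ) 1, ‖D.dr (dy^[3] u) r y‖ ≤ M')
    (hk : 0 < k) (ha : 0 + k ≤ r - k / 2) (hb : r + k / 2 ≤ D.R) :
    normInf (D.localErr J k u r - D.localErr J k u (r - k))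
      ≤ k ^ 3 * D.supΩ (D.dr^[4] u)
        + (Z * (k * mesh J ^ 2 * M' + k ^ 3 * D.supΩ (D.dr^[3] (dy u)))
          + Z * k * (mesh J ^ 2 * M + k ^ 2 * D.supΩ (D.dr^[2] (dy u))))
        + Z * (k ^ 3 * D.supΩ (D.dr^[3] u)) := by
  have hr : r ∈ Icc 0 D.R := ⟨by linarith, by linarith⟩
  have hr' : r - k ∈ Icc 0 D.R := ⟨by linarith, by linarith⟩
  have hZ0 := (hZ.zeta r hr).nonneg
  have hM0 : 0 ≤ M := (norm_nonneg _).trans (hM r hr 0 (by simp))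
  have hM0' : 0 ≤ M' := (norm_nonneg _).trans (hM' r hr 0 (by simp))
  have n1 := D.supΩ_nonneg (D.dr^[3] u)
  have n2 := D.supΩ_nonneg (D.dr^[2] (dy u))
  have n3 := D.supΩ_nonneg (D.dr^[4] u)
  have n4 := D.supΩ_nonneg (D.dr^[3] (dy u))
  refine normInf_le (by positivity) fun j hj hjJ => ?_
  change ‖(D.localErr J k u r).1 j - (D.localErr J k u (r - k)).1 j‖ ≤ _
  rw [localErr, localErr, ofInterior_apply _ hj hjJ, ofInterior_apply _ hj hjJ]
  have hy := node_mem hjJ.le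
  set q := quotErr (fun t => u t (node J j)) (fun t => D.dr u t (node J j)) k
  set A := avgErr (fun t => u t (node J j)) k
  have e : q r - (D.δ r : ℂ) * ((node J j : ℂ) * centralErr J k u r j)
      - Complex.I * (D.lam / D.q) * A r
      - (q (r - k) - (D.δ (r - k) : ℂ) * ((node J j : ℂ) * centralErr J k u (r - k) j)
        - Complex.I * (D.lam / D.q) * A (r - k))
      = (q r - q (r - k))
        - ((D.δ r : ℂ) * ((node J j : ℂ) * (centralErr J k u r j - centralErr J k u (r - k) j))
          + ((D.δ r : ℂ) - D.δ (r - k)) * ((node J j : ℂ) * centralErr J k u (r - k) j))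
        - Complex.I * (D.lam / D.q) * (A r - A (r - k)) := by ring
  rw [e]
  refine norm_sub_le_of_le (norm_sub_le_of_le (norm_quotErr_dr_sub_le hu hk ha hb hy)
    (norm_add_le_of_le ?_ ?_)) ?_
  · rw [norm_mul, norm_mul]
    refine mul_le_mul (hZ.delta r hr) ?_ (by positivity) hZ0
    exact (mul_le_of_le_one_left (norm_nonneg _) (norm_node_le hjJ.le)).trans
      (norm_centralErr_sub_le hu hM' hk ha hb hj hjJ)
  · rw [norm_mul, norm_mul]
    have hδ := hZ.delta_sub r hr (r - k) hr'
    rw [sub_sub_cancel, abs_of_pos hk] at hδ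
    refine mul_le_mul hδ ?_ (by positivity) (by positivity)
    exact (mul_le_of_le_one_left (norm_nonneg _) (norm_node_le hjJ.le)).trans
      (norm_centralErr_le hu hM hk (by linarith) (by linarith) hj hjJ)
  · rw [norm_mul, norm_mul, Complex.norm_I, one_mul]
    exact mul_le_mul hZ.lam (norm_avgErr_dr_sub_le (by norm_num) hu hk ha hb hy)
      (norm_nonneg _) hZ0

lemma IsSolution.normInf_sourceErr_le (h : D.IsSolution u₀ u)
    (hu : ContDiffOn ℝ (4 : ℕ) (Function.uncurry u) D.Ω) (hZ : D.CoefBound Z) (hc : 0 < c)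
    (hJ : 2 ≤ J) (hcoer : ∀ r ∈ Icc 0 D.R, Coercive c J (D.ζ r))
    (hM : ∀ r ∈ Icc 0 D.R, ∀ y ∈ Icc (0 : ℝ) 1, ‖dy^[3] u r y‖ ≤ M)
    (hk : 0 < k) (ha : 0 ≤ r - k / 2) (hb : r + k / 2 ≤ D.R) :
    normInf (D.sourceErr J k u r) ≤ 6 * ellConst' c Z * Z * (mesh J ^ 2 * M)
      + Z * (k ^ 2 * D.supΩ (D.dr^[2] (dy u))) := by
  have hr : r ∈ Icc 0 D.R := ⟨by linarith, by linarith⟩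
  have hZ0 := (hZ.zeta r hr).nonneg
  have hM0 : 0 ≤ M := (norm_nonneg _).trans (hM r hr 0 (by simp))
  have hE := ellConst'_pos hc hZ0
  have n2 := D.supΩ_nonneg (D.dr^[2] (dy u))
  have h1 := h.normInf_ellipErr_le hu hZ hc hJ (hcoer r hr) hM hr
  refine normInf_le (by positivity) fun j hj hjJ => ?_
  change ‖(D.ellipErr J u r).1 j - (ofInterior J _).1 j‖ ≤ _
  rw [ofInterior_apply _ hj hjJ]
  refine norm_sub_le_of_le ((norm_le_normInf _ hj hjJ).trans h1) ?_
  rw [norm_mul, norm_mul, Complex.norm_I, one_mul]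
  exact mul_le_mul (hZ.xi r hr) (h.norm_avgErr_le_dy hu hk ha hb (node_mem hjJ.le))
    (norm_nonneg _) hZ0

lemma IsSolution.normInf_sourceErr_sub_le (h : D.IsSolution u₀ u)
    (hu : ContDiffOn ℝ (4 : ℕ) (Function.uncurry u) D.Ω) (hZ : D.CoefBound Z) (hc : 0 < c)
    (hJ : 2 ≤ J) (hcoer : ∀ r ∈ Icc 0 D.R, Coercive c J (D.ζ r))
    (hM : ∀ r ∈ Icc 0 D.R, ∀ y ∈ Icc (0 : ℝ) 1, ‖dy^[3] u r y‖ ≤ M)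
    (hM' : ∀ r ∈ Icc 0 D.R, ∀ y ∈ Icc (0 : ℝ) 1, ‖D.dr (dy^[3] u) r y‖ ≤ M')
    (hk : 0 < k) (ha : 0 + k ≤ r - k / 2) (hb : r + k / 2 ≤ D.R) :
    normInf (D.sourceErr J k u r - D.sourceErr J k u (r - k))
      ≤ 2 * ellConst' c Z * diffConst c Z * (k * mesh J ^ 2 * (M + M'))
        + (Z * (k ^ 3 * D.supΩ (D.dr^[3] u)) + Z * k * (k ^ 2 * D.supΩ (D.dr^[2] (dy u)))) := by
  have hr : r ∈ Icc 0 D.R := ⟨by linarith, by linarith⟩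
  have hr' : r - k ∈ Icc 0 D.R := ⟨by linarith, by linarith⟩
  have hZ0 := (hZ.zeta r hr).nonneg
  have n1 := D.supΩ_nonneg (D.dr^[3] u)
  have n2 := D.supΩ_nonneg (D.dr^[2] (dy u))
  have h1 := h.normInf_ellipErr_sub_le hu hZ hc hJ (hcoer r hr) (hcoer _ hr') hM hM' hr hr'
  rw [sub_sub_cancel, abs_of_pos hk] at h1
  have h10 := (normInf_nonneg _).trans h1
  refine normInf_le (by positivity) fun j hj hjJ => ?_
  have e : (D.sourceErr J k u r - D.sourceErr J k u (r - k)).1 j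
      = (D.ellipErr J u r - D.ellipErr J u (r - k)).1 j
        - (Complex.I * D.ξ r * (avgErr (fun t => u t (node J j)) k r
            - avgErr (fun t => u t (node J j)) k (r - k))
          + Complex.I * (D.ξ r - D.ξ (r - k)) * avgErr (fun t => u t (node J j)) k (r - k)) := by
    change ((D.ellipErr J u r).1 j - (ofInterior J _).1 j)
      - ((D.ellipErr J u (r - k)).1 j - (ofInterior J _).1 j)
      = (D.ellipErr J u r).1 j - (D.ellipErr J u (r - k)).1 j - _
    rw [ofInterior_apply _ hj hjJ, ofInterior_apply _ hj hjJ]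
    ring
  rw [e]
  refine norm_sub_le_of_le ((norm_le_normInf _ hj hjJ).trans h1) (norm_add_le_of_le ?_ ?_)
  · rw [norm_mul, norm_mul, Complex.norm_I, one_mul]
    exact mul_le_mul (hZ.xi r hr)
      (norm_avgErr_dr_sub_le (by norm_num) hu hk ha hb (node_mem hjJ.le)) (norm_nonneg _) hZ0
  · rw [norm_mul, norm_mul, Complex.norm_I, one_mul]
    have hξ := hZ.xi_sub r hr (r - k) hr'
    rw [sub_sub_cancel, abs_of_pos hk] at hξ
    exact mul_le_mul hξ
      -- The varying `ξ` leaves an undifferenced averaging error. Bounding it by `u_yrr` instead of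
      -- `u_rr` is what the second estimate demands, as `u_rr` is absent from it.
      (h.norm_avgErr_le_dy hu hk (by linarith) (by linarith) (node_mem hjJ.le)) (norm_nonneg _)
      (by positivity)

end Data

end CNFD

/-! ### Assembly of the two truncation estimates -/

open CNFD CNFD.Data in
theorem mainTheorem3 (D : CNFD.Data) :
    ∃ C : ℝ, 0 < C ∧ ∀ J N : ℕ, 3 ≤ J → 1 ≤ N → (D.CondRe J ∨ D.CondIm) →
      (∀ r ∈ Icc 0 D.R, IsUnit (D.ellipH J r)) ∧
      ∀ (u₀ : ℝ → ℂ) (u : ℝ → ℝ → ℂ),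
        ContDiffOn ℝ 4 (Function.uncurry u) D.Ω → D.IsSolution u₀ u →
        ∀ η : ℕ → CNFD.Xh J,
          (∀ n, 1 ≤ n → n ≤ N → D.IsTruncationError J N u n (η n)) →
          (∀ m, 1 ≤ m → m ≤ N →
            CNFD.normInf (η m) ≤
              C * (D.step N ^ 2 * D.B1 u + CNFD.mesh J ^ 2 * D.B2 u)) ∧
          (∀ n, 2 ≤ n → n ≤ N →
            CNFD.normInf (η n - η (n - 1)) ≤
              C * (D.step N ^ 3 *
                    (D.supΩ (D.dr^[4] u) + D.supΩ (D.dr^[3] u)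
                      + D.supΩ (D.dr^[2] (CNFD.dy u)) + D.supΩ (D.dr^[3] (CNFD.dy u)))
                + CNFD.mesh J ^ 3 *
                    (D.supΩ (CNFD.dy^[4] u) + D.maxSemiI 3 u)
                + D.step N * CNFD.mesh J ^ 2 *
                    (D.supΩ (CNFD.dy^[3] u) + D.supΩ (D.dr (CNFD.dy^[3] u))
                      + D.maxSemiI 2 u + D.maxSemiI 2 (D.dr u)))) := by
  obtain ⟨c, hc, hcoer⟩ := exists_coercive D
  obtain ⟨Z, hZ0, hZ⟩ := exists_coefBound D
  have hK := stabConst_pos hc hZ0.le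
  have hE' := ellConst'_pos hc hZ0.le
  have hP : 0 < diffConst c Z := by
    have := ellConst_pos hc hZ0.le
    unfold diffConst; positivity
  set K := stabConst c Z with hKdef
  set E' := ellConst' c Z with hEdef
  set P := diffConst c Z with hPdef
  -- A sum of positive terms that dominates every coefficient met when the bounds below are
  -- collected.
  set C : ℝ := 1 + 2 * Z + 2 * K * Z + 6 * K * E' * Z + 2 * K * E' * P
    + 6 * K * K * Z * E' * Z + K * K * Z * Z with hC
  have pKZ : 0 < K * Z := by positivity
  have pKEZ : 0 < K * E' * Z := by positivity
  have pKEP : 0 < K * E' * P := by positivity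
  have pKKZEZ : 0 < K * K * Z * E' * Z := by positivity
  have pKKZZ : 0 < K * K * Z * Z := by positivity
  have hmulC : ∀ {a x : ℝ}, a ≤ C → 0 ≤ x → a * x ≤ C * x := fun h hx =>
    mul_le_mul_of_nonneg_right h hx
  refine ⟨C, by positivity, fun J N hJ hN hcond => ?_⟩
  have hco := hcoer J hJ hcond
  have hunit : ∀ r ∈ Icc 0 D.R, IsUnit (D.ellipH J r) := fun r hr =>
    isUnit_ellipH hZ hc (by omega) hr (hco r hr)
  refine ⟨hunit, fun u₀ u hu4 hsol η hη => ?_⟩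
  have hu : ContDiffOn ℝ (4 : ℕ) (Function.uncurry u) D.Ω := by exact_mod_cast hu4
  have hk := D.step_pos hN
  have hm := mesh_pos (J := J) (by omega)
  set k := D.step N with hkdef
  have hpos : ∀ n, 1 ≤ n → n ≤ N → 0 ≤ D.rmid N n - k / 2 ∧ D.rmid N n + k / 2 ≤ D.R :=
    fun n h1 h2 => by
      rw [hkdef, rmid_add h1, rmid_sub h1]
      exact ⟨(rnode_mem hN (by omega)).1, (rnode_mem hN h2).2⟩
  have hmid : ∀ n, 1 ≤ n → n ≤ N → D.rmid N n ∈ Icc 0 D.R := fun n h1 h2 => by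
    obtain ⟨ha, hb⟩ := hpos n h1 h2
    exact ⟨by linarith, by linarith⟩
  have heq : ∀ n, 1 ≤ n → n ≤ N → η n = D.localErr J k u (D.rmid N n)
      + D.solH J (D.rmid N n) (D.sourceErr J k u (D.rmid N n)) := fun n h1 h2 =>
    hsol.truncationError_eq (by omega) hN h1 h2 (hunit _ (hmid n h1 h2)) (hη n h1 h2)
  have hcont3 : ContDiffOn ℝ (1 : ℕ) (Function.uncurry (dy^[3] u)) D.Ω := contDiffOn_dy_iterate hu
  constructor
  · intro n h1 h2
    obtain ⟨ha, hb⟩ := hpos n h1 h2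
    have hM := fun r (hr : r ∈ Icc 0 D.R) y (hy : y ∈ Icc (0 : ℝ) 1) =>
      norm_le_maxSemiI (m := 3) hcont3.continuousOn hr hy
    have l1 := normInf_localErr_le (J := J) hu hZ hM hk ha hb
    have l2 := hsol.normInf_sourceErr_le hu hZ hc (by omega) hco hM hk ha hb
    have l3 := normInf_solH_le hZ hc (by omega : 2 ≤ J) (hmid n h1 h2) (hco _ (hmid n h1 h2))
      (D.sourceErr J k u (D.rmid N n))
    have l4 := mul_le_mul_of_nonneg_left l2 hK.le
    rw [heq n h1 h2]
    refine (normInf_add_le _ _).trans ((add_le_add l1 (l3.trans l4)).trans ?_)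
    rw [B1, B2, ← hEdef]
    have n1 : 0 ≤ k ^ 2 * D.supΩ (D.dr^[3] u) := mul_nonneg (by positivity) (supΩ_nonneg _)
    have n2 : 0 ≤ k ^ 2 * D.supΩ (D.dr^[2] (dy u)) := mul_nonneg (by positivity) (supΩ_nonneg _)
    have n3 : 0 ≤ k ^ 2 * D.supΩ (D.dr^[2] u) := mul_nonneg (by positivity) (supΩ_nonneg _)
    have n4 : 0 ≤ mesh J ^ 2 * D.maxSemiI 3 u := mul_nonneg (by positivity) (maxSemiI_nonneg _ _)
    have m1 := hmulC (a := 1) (by linarith) n1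
    have m2 := hmulC (a := Z + K * Z) (by linarith) n2
    have m3 := hmulC (a := Z) (by linarith) n3
    have m4 := hmulC (a := Z + 6 * (K * E' * Z)) (by linarith) n4
    linarith
  · intro n h1 h2
    obtain ⟨ha, hb⟩ := hpos n (by omega) h2
    obtain ⟨ha', hb'⟩ := hpos (n - 1) (by omega) (by omega)
    have hr := hmid n (by omega) h2
    have hr' := hmid (n - 1) (by omega) (by omega)
    rw [heq n (by omega) h2, heq (n - 1) (by omega) (by omega)]
    rw [rmid_pred h1] at ha' hb' hr' ⊢
    set r := D.rmid N n with hrdef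
    rw [← hkdef] at ha' hb' hr' ⊢
    have hM := fun r (hr : r ∈ Icc 0 D.R) y (hy : y ∈ Icc (0 : ℝ) 1) =>
      norm_le_supΩ hcont3.continuousOn hr hy
    have hM' := fun r (hr : r ∈ Icc 0 D.R) y (hy : y ∈ Icc (0 : ℝ) 1) =>
      norm_le_supΩ (contDiffOn_dr (m := 0) hcont3).continuousOn hr hy
    -- The shifted difference `f(t) - f(t - k)` lives on `[k, R]`; since `n ≥ 2`, the preceding step
    -- lies in `[0, R]`.
    have hak : 0 + k ≤ r - k / 2 := by linarith
    have l1 := normInf_localErr_sub_le (J := J) hu hZ hM hM' hk hak hb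
    have l2 := hsol.normInf_sourceErr_le hu hZ hc (by omega) hco hM hk ha' hb'
    have l3 := hsol.normInf_sourceErr_sub_le hu hZ hc (by omega) hco hM hM' hk hak hb
    have l4 := normInf_solH_sub_le hZ hc (by omega : 2 ≤ J) hr hr' (hco _ hr) (hco _ hr')
      (D.sourceErr J k u r) (D.sourceErr J k u (r - k))
    rw [sub_sub_cancel, abs_of_pos hk, ← hKdef] at l4
    have l5 : normInf (D.solH J r (D.sourceErr J k u r)
        - D.solH J (r - k) (D.sourceErr J k u (r - k))) ≤ _ :=
      l4.trans (mul_le_mul_of_nonneg_left (add_le_add l3 (mul_le_mul_of_nonneg_left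
        (mul_le_mul_of_nonneg_left l2 hK.le) (by positivity))) hK.le)
    rw [add_sub_add_comm]
    refine (normInf_add_le _ _).trans ((add_le_add l1 l5).trans ?_)
    rw [← hEdef, ← hPdef]
    have n1 : 0 ≤ k ^ 3 * D.supΩ (D.dr^[4] u) := mul_nonneg (by positivity) (supΩ_nonneg _)
    have n2 : 0 ≤ k ^ 3 * D.supΩ (D.dr^[3] u) := mul_nonneg (by positivity) (supΩ_nonneg _)
    have n3 : 0 ≤ k ^ 3 * D.supΩ (D.dr^[2] (dy u)) := mul_nonneg (by positivity) (supΩ_nonneg _)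
    have n4 : 0 ≤ k ^ 3 * D.supΩ (D.dr^[3] (dy u)) := mul_nonneg (by positivity) (supΩ_nonneg _)
    have n5 : 0 ≤ k * mesh J ^ 2 * D.supΩ (dy^[3] u) := mul_nonneg (by positivity) (supΩ_nonneg _)
    have n6 : 0 ≤ k * mesh J ^ 2 * D.supΩ (D.dr (dy^[3] u)) :=
      mul_nonneg (by positivity) (supΩ_nonneg _)
    -- The `h³` terms and the second-order seminorms only enlarge the right-hand side; their
    -- nonnegativity is enough.
    have n7 : 0 ≤ C * (mesh J ^ 3 * (D.supΩ (dy^[4] u) + D.maxSemiI 3 u)) :=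
      mul_nonneg (by positivity) (mul_nonneg (by positivity)
        (add_nonneg (supΩ_nonneg _) (maxSemiI_nonneg _ _)))
    have n8 : 0 ≤ C * (k * mesh J ^ 2 * (D.maxSemiI 2 u + D.maxSemiI 2 (D.dr u))) :=
      mul_nonneg (by positivity) (mul_nonneg (by positivity)
        (add_nonneg (maxSemiI_nonneg _ _) (maxSemiI_nonneg _ _)))
    have m1 := hmulC (a := 1) (by linarith) n1
    have m2 := hmulC (a := Z + K * Z) (by linarith) n2
    have m3 := hmulC (a := Z + K * Z + K * K * Z * Z) (by linarith) n3
    have m4 := hmulC (a := Z) (by linarith) n4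
    have m5 := hmulC (a := Z + 2 * (K * E' * P) + 6 * (K * K * Z * E' * Z)) (by linarith) n5
    have m6 := hmulC (a := Z + 2 * (K * E' * P)) (by linarith) n6
    linarith
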